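/- **Theorem.** Let $K$ be an algebraically closed field, $Y$ an algebraic variety over $K$ (a reduced scheme of finite type over $K$, possibly reducible) and $y\in Y$ a closed point. An étale neighbourhood of $y$ is a pair $(U,x)$ consisting of an étale morphism of finite type $U\to Y$ and a point $x\in U$ lying over $y$; morphisms of étale neighbourhoods are $Y$-morphisms taking the chosen point to the chosen point. Then the direct limit $$\mathcal O_{y,Y}^{\wedge}=\varinjlim_{(U,x)}\mathcal O_U(U)$$ of commutative rings over all étale neighbourhoods of $y$ exists, and, with the canonical map $\varphi:\mathcal O_{y,Y}\to\mathcal O_{y,Y}^{\wedge}$ (which sends the germ of a function on a Zariski open neighbourhood $V$ of $y$ to its class on $V\hookrightarrow Y$), it is the Henselisation of $\mathcal O_{y,Y}$. That is: 1. $\mathcal O_{y,Y}^{\wedge}$ is a Henselian local ring, $\varphi$ is a local homomorphism, and every local homomorphism from $\mathcal O_{y,Y}$ to a Henselian local ring $B$ factors through $\varphi$ by a unique local homomorphism $\mathcal O_{y,Y}^{\wedge}\to B$. 2. It is a smallest Henselian ring containing $\mathcal O_{y,Y}$ and is algebraic over it: $\varphi$ is injective; every element of $\mathcal O_{y,Y}^{\wedge}$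 is a root of a polynomial over $\mathcal O_{y,Y}$ whose leading coefficient is not a zero divisor; and the only Henselian local subring of $\mathcal O_{y,Y}^{\wedge}$ that contains $\varphi(\mathcal O_{y,Y})$ is $\mathcal O_{y,Y}^{\wedge}$ itself. 3. $\mathcal O_{y,Y}^{\wedge}$ satisfies the multivariable Hensel lifting criterion: if $k$ is its residue field, $n\ge 0$, $f_1,\dots,f_n\in\mathcal O_{y,Y}^{\wedge}[x_1,\dots,x_n]$, and $\bar a\in k^n$ is a common root of the reductions $\bar f_1,\dots,\bar f_n$ with $\det(\partial\bar f_i/\partial x_j)(\bar a)\neq 0$, then $\bar a$ lifts to a common root of $f_1,\dots,f_n$ in $(\mathcal O_{y,Y}^{\wedge})^n$. 4. If $\mathcal O_{y,Y}$ is an integrally closed domain, then $\mathcal O_{y,Y}^{\wedge}$ is a domain. Whenever $\mathcal O_{y,Y}$ and $\mathcal O_{y,Y}^{\wedge}$ are domains, $\mathcal O_{y,Y}^{\wedge}$ embeds over $\mathcal O_{y,Y}$ in the algebraic closure $\Omega$ of $\operatorname{Frac}(\mathcal O_{y,Y})$, and it embeds over $\mathcal O_{y,Y}$ in every Henselian local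 ring $B$ with $\mathcal O_{y,Y}\subset B\subset\Omega$ that dominates $\mathcal O_{y,Y}$. -/

import Mathlib

open CategoryTheory AlgebraicGeometry Opposite

universe u v w

noncomputable section

/-! ### Algebraic varieties and their étale neighbourhoods -/

/-- An algebraic variety over an algebraically closed field `K`: a reduced scheme of finite type
over `K`. It may be reducible. -/
structure AlgVariety (K : Type u) [Field K] [IsAlgClosed K] where
  /-- The underlying scheme. -/
  toScheme : Scheme.{u}
  /-- The structure morphism. -/
  str : toScheme ⟶ Spec (CommRingCat.of K)
  [locallyOfFiniteType : LocallyOfFiniteType str]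
  [quasiCompact : QuasiCompact str]
  [isReduced : IsReduced toScheme]

namespace AlgVariety

variable {K : Type u} [Field K] [IsAlgClosed K]

attribute [instance] AlgVariety.locallyOfFiniteType AlgVariety.quasiCompact AlgVariety.isReduced

instance (Y : AlgVariety K) : IsLocallyNoetherian Y.toScheme :=
  LocallyOfFiniteType.isLocallyNoetherian Y.str

/-- The points of a variety in the classical sense are the closed points of the scheme. -/
def Point (Y : AlgVariety K) : Type u := {y : Y.toScheme // IsClosed ({y} : Set Y.toScheme)}

/-- The Zariski local ring of `Y` at `y`. -/
abbrev localRing (Y : AlgVariety K) (y : Y.Point) : CommRingCat.{u} :=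
  Y.toScheme.presheaf.stalk y.1

end AlgVariety

/-- An étale neighbourhood `(U, x) ⟶ (Y, y)`: an étale morphism of finite type `U ⟶ Y` with a
point `x` of `U` above `y`. -/
structure EtaleNhd (Y : Scheme.{u}) (y : Y) where
  /-- The total space. -/
  left : Scheme.{u}
  /-- The étale morphism to `Y`. -/
  hom : left ⟶ Y
  [etale : Etale hom]
  [quasiCompact : QuasiCompact hom]
  /-- The chosen point of the total space. -/
  pt : left
  map_pt : hom pt = y

attribute [instance] EtaleNhd.etale EtaleNhd.quasiCompact

namespace EtaleNhd

variable {Y : Scheme.{u}} {y : Y}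

/-- Morphisms of étale neighbourhoods: morphisms over `Y` that carry the chosen point to the
chosen point. -/
@[ext]
structure Mor (U V : EtaleNhd Y y) where
  /-- The underlying morphism of schemes. -/
  map : U.left ⟶ V.left
  comm : map ≫ V.hom = U.hom
  map_pt : map U.pt = V.pt

instance : Category (EtaleNhd Y y) where
  Hom := Mor
  id U := ⟨𝟙 _, by simp, by simp⟩
  comp f g := ⟨f.map ≫ g.map, by rw [Category.assoc, g.comm, f.comm],
    by rw [Scheme.Hom.comp_apply, f.map_pt, g.map_pt]⟩
  id_comp f := Mor.ext (Category.id_comp f.map)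
  comp_id f := Mor.ext (Category.comp_id f.map)
  assoc f g h := Mor.ext (Category.assoc f.map g.map h.map)

/-- The system of rings of regular functions `(U, x) ↦ 𝒪_U(U)` on the étale neighbourhoods
of `y`; the local ring of `Y` at `y` in the étale topology is its direct limit. -/
def sections (Y : Scheme.{u}) (y : Y) : (EtaleNhd Y y)ᵒᵖ ⥤ CommRingCat.{u} where
  obj U := Γ(U.unop.left, ⊤)
  map f := (Mor.map f.unop).appTop
  map_id _ := Scheme.Hom.id_appTop
  map_comp f g := Scheme.Hom.comp_appTop (Mor.map g.unop) (Mor.map f.unop)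

/-- A Zariski open neighbourhood of `y`, regarded as an étale neighbourhood. -/
def ofOpen [IsLocallyNoetherian Y] (V : Y.Opens) (hV : y ∈ V) : EtaleNhd Y y where
  left := V
  hom := V.ι
  pt := ⟨y, hV⟩
  map_pt := rfl

/-- The inclusion of a Zariski open neighbourhood in a larger one. -/
def ofLE [IsLocallyNoetherian Y] {V W : Y.Opens} (h : V ≤ W) (hV : y ∈ V) :
    ofOpen V hV ⟶ ofOpen W (h hV) where
  map := Y.homOfLE h
  comm := Y.homOfLE_ι h
  map_pt := W.ι.isOpenEmbedding.injective
    (congrArg (fun g : V.toScheme ⟶ Y => g ⟨y, hV⟩) (Y.homOfLE_ι h))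

/-- The structure map of a cocone at an étale neighbourhood: a regular function on `U` is sent to
its class in the limit. -/
def cls (c : Limits.Cocone (sections Y y)) (U : EtaleNhd Y y) : Γ(U.left, ⊤) ⟶ c.pt :=
  c.ι.app (op U)

theorem map_cls (c : Limits.Cocone (sections Y y)) {U V : EtaleNhd Y y} (g : U ⟶ V) :
    (Mor.map g).appTop ≫ cls c U = cls c V :=
  c.w g.op

/-- The class in the limit of a function on a Zariski open neighbourhood of `y`. -/
def clsOpen [IsLocallyNoetherian Y] (c : Limits.Cocone (sections Y y)) (V : Y.Opens)
    (hV : y ∈ V) : Γ(Y, V) ⟶ c.pt :=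
  V.topIso.inv ≫ (cls c (ofOpen V hV) : Γ(V.toScheme, ⊤) ⟶ c.pt)

theorem map_topIso_inv {V W : Y.Opens} (h : V ≤ W) :
    Y.presheaf.map (homOfLE h).op ≫ V.topIso.inv = W.topIso.inv ≫ (Y.homOfLE h).appTop := by
  rw [Scheme.homOfLE_appTop, Scheme.Opens.topIso_inv, Scheme.Opens.topIso_inv]
  exact ((Y.presheaf.map_comp _ _).symm.trans (congrArg Y.presheaf.map (Subsingleton.elim _ _))).trans
    (Y.presheaf.map_comp _ _)

theorem map_topIso_inv_comp {V W : Y.Opens} (h : V ≤ W) {R : CommRingCat.{u}}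
    (k : Γ(V.toScheme, ⊤) ⟶ R) (m : Γ(W.toScheme, ⊤) ⟶ R) (hm : (Y.homOfLE h).appTop ≫ k = m) :
    Y.presheaf.map (homOfLE h).op ≫ V.topIso.inv ≫ k = W.topIso.inv ≫ m := by
  rw [← hm, ← Category.assoc, map_topIso_inv h, Category.assoc]

theorem map_clsOpen [IsLocallyNoetherian Y] (c : Limits.Cocone (sections Y y))
    {V W : Y.Opens} (h : V ≤ W) (hV : y ∈ V) :
    Y.presheaf.map (homOfLE h).op ≫ clsOpen c V hV = clsOpen c W (h hV) :=
  map_topIso_inv_comp h _ _ (map_cls c (ofLE h hV))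

/-- The canonical ring homomorphism from the Zariski local ring `𝒪_{Y,y}` to (a cocone over the
system, in particular) the direct limit of the rings `𝒪_U(U)`: the germ at `y` of a function on
an open set `V` is sent to the class of this function on the étale neighbourhood `V ⟶ Y`. -/
def fromStalk [IsLocallyNoetherian Y] (c : Limits.Cocone (sections Y y)) :
    Y.presheaf.stalk y ⟶ c.pt :=
  Limits.colimit.desc ((TopologicalSpace.OpenNhds.inclusion y).op ⋙ Y.presheaf)
    { pt := c.pt
      ι :=
        { app := fun V => clsOpen c V.unop.1 V.unop.2
          naturality := fun _ V i =>
            (map_clsOpen c (leOfHom i.unop) V.unop.2).trans (Category.comp_id _).symm } }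

theorem germ_fromStalk [IsLocallyNoetherian Y] (c : Limits.Cocone (sections Y y)) (V : Y.Opens)
    (hV : y ∈ V) : Y.presheaf.germ V y hV ≫ fromStalk c = clsOpen c V hV :=
  Limits.colimit.ι_desc (F := (TopologicalSpace.OpenNhds.inclusion y).op ⋙ Y.presheaf) _ (op (⟨V, hV⟩ : TopologicalSpace.OpenNhds y))

end EtaleNhd

/-! ### Henselisation -/

/-- `φ : R → S` is a Henselisation of the local ring `R`: it is a local homomorphism to a
Henselian local ring, and every local homomorphism from `R` to a Henselian local ring factors
through `φ` by a unique local homomorphism. -/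
structure IsHenselisation {R : Type u} {S : Type v} [CommRing R] [CommRing S] [IsLocalRing R]
    (φ : R →+* S) : Prop where
  henselian : HenselianLocalRing S
  isLocalHom : IsLocalHom φ
  existsUnique_lift : ∀ (B : Type w) [CommRing B] [HenselianLocalRing B] (g : R →+* B)
    [IsLocalHom g], ∃! h : S →+* B, IsLocalHom h ∧ h.comp φ = g

/-- `φ : R → S` presents `S` as a smallest Henselian local ring containing `R`, with `S`
algebraic over the total ring of fractions of `R`. -/
structure IsSmallestHenselian {R : Type u} {S : Type v} [CommRing R] [CommRing S]
    (φ : R →+* S) : Prop where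
  henselian : HenselianLocalRing S
  injective : Function.Injective φ
  algebraic : ∀ s : S, ∃ p : Polynomial R,
    p.leadingCoeff ∈ nonZeroDivisors R ∧ p.eval₂ φ s = 0
  eq_top_of_henselian : ∀ T : Subring S, φ.range ≤ T → HenselianLocalRing T → T = ⊤

/-- For a local domain `R` with a fixed algebraic closure `Ω` of its fraction field,
`φ : R → S` identifies `S` with a subring of `Ω`, and every Henselian local ring `R ⊆ B ⊆ Ω` that
dominates `R` contains a copy of `S` over `R`. (The copies of `S` in `Ω` are in general only
conjugate over `R`, not equal.) -/
structure IsSmallestHenselianInClosure {R : Type u} {S : Type v} [CommRing R] [IsDomain R]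
    [CommRing S] (φ : R →+* S) : Prop where
  exists_embedding : ∃ i : S →+* AlgebraicClosure (FractionRing R), Function.Injective i ∧
    i.comp φ = algebraMap R (AlgebraicClosure (FractionRing R))
  exists_embedding_le : ∀ B : Subalgebra R (AlgebraicClosure (FractionRing R)),
    HenselianLocalRing B → IsLocalHom (algebraMap R B) →
      ∃ i : S →+* B, Function.Injective i ∧ i.comp φ = algebraMap R B

open IsLocalRing in
/-- The multivariable Hensel lifting criterion for a local ring `S` with residue field `k`: a
common root in `kⁿ` of the reductions of `n` polynomials in `n` variables over `S`, at which the
Jacobian determinant does not vanish, lifts to a common root in `Sⁿ`. -/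
def MultivariableHensel (S : Type u) [CommRing S] [IsLocalRing S] : Prop :=
  ∀ (n : ℕ) (f : Fin n → MvPolynomial (Fin n) S) (a : Fin n → ResidueField S),
    (∀ i, MvPolynomial.eval₂ (residue S) a (f i) = 0) →
    (Matrix.of fun i j => MvPolynomial.eval₂ (residue S) a (MvPolynomial.pderiv j (f i))).det ≠ 0 →
    ∃ b : Fin n → S, (∀ i, MvPolynomial.eval b (f i) = 0) ∧ ∀ i, residue S (b i) = a i

end

/-! Fix an affine open `W` containing `y` and put `R = Γ(Y, W)`. Since `K` is algebraically closed,
`y` is a `K`-point and lifts uniquely to a `K`-point through the chosen point of any étale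
neighbourhood. Neighbourhoods affine over `W` are cofinal, and they are the same as étale
`R`-algebras `A` with an `R`-homomorphism `A → K`. So the limit `S` is the filtered colimit of
pointed étale algebras, with an evaluation map `ε : S → K`. `IsEtaleColimit` records just what is
needed of this; the rest is commutative algebra over `R` and over its localisation `O`, the Zariski
local ring.

Two facts drive the algebra. Rigidity: maps from an unramified algebra to a local ring agree once
they agree modulo the maximal ideal (`algHom_ext_of_sub_mem`). Lifting: a residue-field point of an
étale algebra lifts to any Henselian local ring (`HenselianLocalRing.exists_algHom`). Together they
give the universal property. `S` is Henselian because adjoining a simple root of a monic polynomial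
is an étale operation, already performed at a finite stage. Minimality holds because every
`R`-endomorphism of `S` is the identity.

The remaining claims come from flatness (injectivity), from the finiteness of quasi-finite algebras
over the Artinian total ring of fractions (algebraicity), and from the fact that, over a normal
domain, a simple root is a root of a prime factor (`S` is a domain). The embeddings in the algebraic
closure follow from algebraicity and the universal property. -/

noncomputable section

open IsLocalRing TensorProduct

/-! ### Rigidity of unramified algebras, via the separability idempotent. -/

section Unramified

variable {R A B : Type*} [CommRing R] [CommRing A] [CommRing B] [Algebra R A] [Algebra R B]

/-- The separability idempotent `t` of an unramified algebra satisfies `(f a - g a) * (f ⊗ g) t = 0`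
for all pairs of algebra homomorphisms `f`, `g`. -/
theorem Algebra.FormallyUnramified.sub_mul_lift_elem [FormallyUnramified R A] [EssFiniteType R A]
    (f g : A →ₐ[R] B) (a : A) :
    (g a - f a) * TensorProduct.lift f g (fun _ _ => Commute.all _ _) (elem R A) = 0 := by
  have h := congrArg (TensorProduct.lift f g (fun _ _ => Commute.all _ _))
    (one_tmul_sub_tmul_one_mul_elem (R := R) a)
  simpa using h

/-- Two homomorphisms from an unramified algebra to a local ring coincide if they coincide modulo
the maximal ideal. -/
theorem Algebra.FormallyUnramified.algHom_ext_of_sub_mem [FormallyUnramified R A]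
    [EssFiniteType R A] [IsLocalRing B] {f g : A →ₐ[R] B}
    (h : ∀ a, g a - f a ∈ maximalIdeal B) : f = g := by
  set l := TensorProduct.lift f g (fun _ _ => Commute.all _ _) with hl
  -- Modulo the maximal ideal `l` is `f` after multiplication, so it sends the idempotent to `1`
  -- there, hence to a unit. This unit annihilates every `g a - f a`.
  have key : ∀ t : A ⊗[R] A, l t - f (TensorProduct.lmul' R t) ∈ maximalIdeal B := by
    intro t
    induction t with
    | zero => simp
    | add x y hx hy => simpa [add_sub_add_comm] using add_mem hx hy
    | tmul x y =>
      simpa [hl, mul_sub] using Ideal.mul_mem_left _ (f x) (h y)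
  have h1 := key (elem R A)
  rw [lmul_elem, map_one] at h1
  have hu : IsUnit (l (elem R A)) := by
    by_contra hc
    have := sub_mem ((mem_maximalIdeal _).2 hc) h1
    rw [sub_sub_cancel] at this
    exact (Ideal.ne_top_iff_one _).1 (maximalIdeal.isMaximal B).ne_top this
  ext a
  have := sub_mul_lift_elem f g a
  exact (sub_eq_zero.1 ((hu.mul_left_eq_zero).1 this)).symm

/-- Let `ψ` be a point of an unramified algebra `A` with values in a quotient `K` of `R`. Then there
is a function on `A` which is `1` at `ψ` and `0` at all other points in the same fibre. -/
theorem Algebra.FormallyUnramified.exists_separating [FormallyUnramified R A]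
    [EssFiniteType R A] (hR : Function.Surjective (algebraMap R B)) (ψ : A →ₐ[R] B) :
    ∃ b : A, ψ b = 1 ∧ ∀ (χ : A →ₐ[R] B) (a : A), (χ a - ψ a) * χ b = 0 := by
  -- Contract the first tensor factor along `ψ`: its values lift to scalars in `R`, so the result is
  -- an element of `A` that serves all `χ` at once.
  have key : ∀ t : A ⊗[R] A, ∃ b : A, ∀ χ : A →ₐ[R] B,
      TensorProduct.lift ψ χ (fun _ _ => Commute.all _ _) t = χ b := by
    intro t
    induction t with
    | zero => exact ⟨0, by simp⟩
    | add x y hx hy =>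
      obtain ⟨b, hb⟩ := hx
      obtain ⟨c, hc⟩ := hy
      exact ⟨b + c, fun χ => by rw [map_add, map_add, hb, hc]⟩
    | tmul x y =>
      obtain ⟨r, hr⟩ := hR (ψ x)
      exact ⟨algebraMap R A r * y, fun χ => by simp [hr]⟩
  obtain ⟨b, hb⟩ := key (elem R A)
  refine ⟨b, ?_, fun χ a => ?_⟩
  · rw [← hb]
    have : TensorProduct.lift ψ ψ (fun _ _ => Commute.all _ _) = ψ.comp (TensorProduct.lmul' R) := by
      ext <;> simp
    rw [this, AlgHom.comp_apply, lmul_elem, map_one]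
  · rw [← hb]
    exact sub_mul_lift_elem ψ χ a

end Unramified

/-! ### Lifting points of étale algebras to Henselian rings. -/

section Henselian

/-- An étale algebra over a Henselian local ring `B` has a section through each of its points with
values in the residue field of `B`. -/
theorem HenselianLocalRing.exists_algHom_self {B A : Type*} [CommRing B] [HenselianLocalRing B]
    [CommRing A] [Algebra B A] [Algebra.Etale B A] (ψ : A →ₐ[B] ResidueField B) :
    ∃ χ : A →ₐ[B] B, ∀ a, residue B (χ a) = ψ a := by
  have := RingHom.ker_isPrime ψ
  -- Near the point `ker ψ` the algebra is standard étale, so a section amounts to a root of `P.f`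
  -- at which `P.g` is a unit. Hensel's lemma in one variable supplies it.
  obtain ⟨g, hg, hst⟩ := Algebra.IsEtaleAt.exists_isStandardEtale (R := B) (RingHom.ker ψ)
  obtain ⟨⟨P⟩⟩ := hst
  have hgu : ∀ y : Submonoid.powers g, IsUnit (ψ y) := by
    rintro ⟨_, n, rfl⟩
    rw [map_pow]
    exact (IsUnit.mk0 _ hg).pow n
  let ψ' : Localization.Away g →ₐ[B] ResidueField B := IsLocalization.liftAlgHom hgu
  have hψ' : ∀ a, ψ' (algebraMap A _ a) = ψ a := fun a => by simp [ψ']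
  obtain ⟨x₀, hx₀⟩ := residue_surjective (ψ' P.x)
  have hP := P.hasMap.map ψ'
  have hev : ∀ p : Polynomial B, Polynomial.aeval (ψ' P.x) p = residue B (p.eval x₀) := by
    intro p
    rw [← hx₀, ← ResidueField.algebraMap_eq, Polynomial.aeval_algebraMap_apply]
    simp
  obtain ⟨x, hx, hxx⟩ := HenselianLocalRing.is_henselian P.f P.monic_f x₀
    (by rw [← residue_eq_zero_iff, ← hev]; exact hP.1)
    (by rw [← residue_ne_zero_iff_isUnit, ← hev]; exact hP.isUnit_derivative_f.ne_zero)
  have hres : residue B x = ψ' P.x := by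
    rw [← hx₀, ← sub_eq_zero, ← map_sub, residue_eq_zero_iff]
    exact hxx
  have hm : P.HasMap x := by
    refine ⟨by simpa using hx, ?_⟩
    rw [← residue_ne_zero_iff_isUnit, ← ResidueField.algebraMap_eq,
      ← Polynomial.aeval_algebraMap_apply, ResidueField.algebraMap_eq, hres]
    exact hP.2.ne_zero
  let χ : Localization.Away g →ₐ[B] B := (P.lift x hm).comp P.equivRing.toAlgHom
  have hχ : (IsScalarTower.toAlgHom B B (ResidueField B)).comp χ = ψ' := by
    apply P.hom_ext
    simp [χ, hres]
  exact ⟨χ.comp (IsScalarTower.toAlgHom B A _), fun a => by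
    rw [← hψ', ← hχ]; rfl⟩

/-- Homomorphisms from an étale algebra to a Henselian local ring can be constructed modulo the
maximal ideal. -/
theorem HenselianLocalRing.exists_algHom {R A B : Type*} [CommRing R] [CommRing A] [CommRing B]
    [Algebra R A] [Algebra.Etale R A] [HenselianLocalRing B] [Algebra R B]
    (ψ : A →ₐ[R] ResidueField B) :
    ∃ χ : A →ₐ[R] B, ∀ a, residue B (χ a) = ψ a := by
  -- An `R`-map `A → B` is a section over `B` of the base change `B ⊗ A`.
  obtain ⟨χ, hχ⟩ := HenselianLocalRing.exists_algHom_self (B := B) (A := B ⊗[R] A)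
    (Algebra.TensorProduct.lift (Algebra.ofId B _) ψ (fun _ _ => Commute.all _ _))
  refine ⟨(χ.restrictScalars R).comp Algebra.TensorProduct.includeRight, fun a => ?_⟩
  simp [hχ]

/-- The `n` equations in `n` unknowns define an algebra that becomes étale once the Jacobian is
inverted. The approximate root is a residue-field point of it, and a section through that point is a
true root. -/
theorem HenselianLocalRing.multivariableHensel (S : Type u) [CommRing S] [HenselianLocalRing S] :
    MultivariableHensel S := by
  intro n f a hf hJ
  let P := Algebra.PreSubmersivePresentation.naive (R := S) (v := f) id Function.injective_id
  let A := MvPolynomial (Fin n) S ⧸ Ideal.span (Set.range f)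
  let Q := Algebra.PreSubmersivePresentation.localizationAway (Localization.Away P.jacobian)
    P.jacobian
  -- Adding the inverse of the Jacobian adds one variable and one relation. The relative dimension
  -- stays zero and the new Jacobian is a product of units.
  let PQ : Algebra.SubmersivePresentation S (Localization.Away P.jacobian) _ _ :=
    { Q.comp P with
      jacobian_isUnit := by
        rw [Algebra.PreSubmersivePresentation.comp_jacobian_eq_jacobian_smul_jacobian,
          Algebra.PreSubmersivePresentation.localizationAway_jacobian, Algebra.smul_def]
        exact (IsLocalization.Away.algebraMap_isUnit _).mul
          (IsLocalization.Away.algebraMap_isUnit _) }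
  have := PQ.isStandardSmoothOfRelativeDimension (n := 0)
    (by simp [Algebra.Presentation.dimension])
  have hE : Algebra.Etale S (Localization.Away P.jacobian) :=
    Algebra.Etale.iff_isStandardSmoothOfRelativeDimension_zero.2 this
  have hev : ∀ p : MvPolynomial (Fin n) S,
      MvPolynomial.eval₂ (residue S) a p = MvPolynomial.aeval a p := fun p => rfl
  let ψ₀ : A →ₐ[S] ResidueField S := Ideal.Quotient.liftₐ _ (MvPolynomial.aeval a)
    (Ideal.span_le (I := RingHom.ker (MvPolynomial.aeval a)) |>.2
      (by rintro _ ⟨i, rfl⟩; exact hf i))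
  have hJ' : ψ₀ P.jacobian ≠ 0 := by
    rw [Algebra.PreSubmersivePresentation.jacobian_eq_jacobiMatrix_det]
    change (MvPolynomial.aeval a) P.jacobiMatrix.det ≠ 0
    -- The two Jacobian matrices have their index roles exchanged.
    rw [AlgHom.map_det, ← Matrix.det_transpose]
    convert hJ using 2
    ext i j
    simp [P, hev]
  have hu : ∀ y : Submonoid.powers P.jacobian, IsUnit (ψ₀ y) := by
    rintro ⟨_, m, rfl⟩
    rw [map_pow]
    exact (IsUnit.mk0 _ hJ').pow m
  obtain ⟨χ, hχ⟩ := HenselianLocalRing.exists_algHom_self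
    (IsLocalization.liftAlgHom hu : Localization.Away P.jacobian →ₐ[S] ResidueField S)
  let χ' : MvPolynomial (Fin n) S →ₐ[S] S :=
    (χ.comp (IsScalarTower.toAlgHom S A _)).comp (Ideal.Quotient.mkₐ S _)
  have hχ' : χ' = MvPolynomial.aeval fun i => χ' (MvPolynomial.X i) :=
    MvPolynomial.algHom_ext fun i => by simp
  refine ⟨fun i => χ' (MvPolynomial.X i), fun i => ?_, fun i => ?_⟩
  · rw [← MvPolynomial.coe_aeval_eq_eval]
    change (MvPolynomial.aeval fun i => χ' (MvPolynomial.X i)) (f i) = 0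
    rw [← hχ']
    have : Ideal.Quotient.mkₐ S (Ideal.span (Set.range f)) (f i) = 0 :=
      Ideal.Quotient.eq_zero_iff_mem.2 (Ideal.subset_span ⟨i, rfl⟩)
    simp only [χ', AlgHom.comp_apply, this, map_zero]
  · change residue S (χ (algebraMap A _ (Ideal.Quotient.mk _ (MvPolynomial.X i)))) = a i
    rw [hχ, IsLocalization.liftAlgHom_apply, IsLocalization.lift_eq]
    change MvPolynomial.aeval a (MvPolynomial.X i) = a i
    simp

end Henselian
-- Étale algebras over normal domains.
section NormalDomain

/-- Over an integrally closed domain, a monic polynomial which is irreducible is prime. -/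
theorem Polynomial.Monic.prime_of_irreducible {R : Type*} [CommRing R] [IsDomain R]
    [IsIntegrallyClosed R] {p : Polynomial R} (hm : p.Monic) (hp : Irreducible p) : Prime p := by
  have hinj := FaithfulSMul.algebraMap_injective R (FractionRing R)
  -- Gauss's lemma: `p` stays irreducible over the fraction field, hence is prime there, and
  -- divisibility by a monic polynomial descends.
  have hp' := ((hm.irreducible_iff_irreducible_map_fraction_map (K := FractionRing R)).1 hp).prime
  refine ⟨hm.ne_zero, hp.not_isUnit, fun a b hab => ?_⟩
  have := hp'.dvd_or_dvd (a := a.map (algebraMap R (FractionRing R)))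
    (b := b.map (algebraMap R (FractionRing R))) (by
      rw [← Polynomial.map_mul]
      exact Polynomial.map_dvd _ hab)
  simpa only [Polynomial.map_dvd_map _ hinj hm] using this

/-- A simple root, in a local ring, of a monic polynomial over an integrally closed domain is a root
of a prime factor. -/
theorem Polynomial.exists_prime_dvd_of_monic_of_aeval_eq_zero {R S : Type*} [CommRing R]
    [IsDomain R]
    [IsIntegrallyClosed R] [CommRing S] [IsLocalRing S] [Algebra R S] (x : S) (d : ℕ) :
    ∀ f : Polynomial R, f.Monic → f.natDegree ≤ d → aeval x f = 0 → IsUnit (aeval x f.derivative) →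
      ∃ p : Polynomial R, Prime p ∧ p ∣ f ∧ aeval x p = 0 := by
  induction d with
  | zero =>
    intro f hf hd h0
    rw [hf.natDegree_eq_zero.1 (Nat.le_zero.1 hd)] at h0
    simp at h0
  | succ d ih =>
    intro f hf hd h0 h1
    by_cases hirr : Irreducible f
    · exact ⟨f, hf.prime_of_irreducible hirr, dvd_rfl, h0⟩
    have hf1 : f ≠ 1 := by
      rintro rfl
      simp at h0
    have hdec := (not_congr (hf.irreducible_iff_natDegree)).1 hirr
    simp only [not_and, not_forall, not_or] at hdec
    obtain ⟨g, h, hg, hh, hgh, hg0, hh0⟩ := hdec hf1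
    have hdeg : g.natDegree + h.natDegree = f.natDegree := by rw [← hgh, hg.natDegree_mul hh]
    have key : ∀ g h : Polynomial R, g.Monic → g * h = f → g.natDegree ≤ d →
        IsUnit (aeval x h) → ∃ p : Polynomial R, Prime p ∧ p ∣ f ∧ aeval x p = 0 := by
      intro g h hg hgh hd hu
      have hgx : aeval x g = 0 := by
        rw [← hgh, map_mul] at h0
        exact (hu.mul_left_eq_zero).1 h0
      obtain ⟨p, hp, hpg, hpx⟩ := ih g hg hd hgx (by
        rw [← hgh, derivative_mul, map_add, map_mul, map_mul, hgx, zero_mul, add_zero] at h1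
        exact isUnit_of_mul_isUnit_left h1)
      exact ⟨p, hp, hgh ▸ hpg.mul_right h, hpx⟩
    have h1' := h1
    rw [← hgh, derivative_mul, map_add, map_mul, map_mul] at h1'
    -- As `g'h + gh'` is a unit at `x`, so is one summand. Thus one of `g`, `h` is a unit at `x`,
    -- and `x` is a simple root of the other, whose degree is smaller.
    rcases IsLocalRing.isUnit_or_isUnit_of_isUnit_add h1' with hu | hu
    · exact key g h hg hgh (by omega) (isUnit_of_mul_isUnit_right hu)
    · exact key h g hh ((mul_comm _ _).trans hgh) (by omega) (isUnit_of_mul_isUnit_left hu)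

/-- The local rings of an étale algebra over an integrally closed domain have no zero divisors. -/
theorem Algebra.Etale.eq_zero_or_eq_zero_of_mul_eq_zero {R A S : Type*} [CommRing R] [IsDomain R]
    [IsIntegrallyClosed R] [CommRing A] [Algebra R A] [Algebra.Etale R A] [CommRing S]
    [IsLocalRing S] [Algebra R S] (α : A →ₐ[R] S) {a b : A} (hab : a * b = 0) :
    α a = 0 ∨ α b = 0 := by
  let q := (maximalIdeal S).comap α
  obtain ⟨c, hc, ⟨⟨P⟩⟩⟩ := Algebra.IsEtaleAt.exists_isStandardEtale (R := R) q
  have hcu : IsUnit (α c) := by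
    by_contra h
    exact hc h
  have hu : ∀ y : Submonoid.powers c, IsUnit (α y) := by
    rintro ⟨_, n, rfl⟩
    rw [map_pow]
    exact hcu.pow n
  let α' : Localization.Away c →ₐ[R] S := IsLocalization.liftAlgHom hu
  have hα' : ∀ a, α' (algebraMap A _ a) = α a := fun a => by simp [α']
  have hroot := P.hasMap.map α'
  obtain ⟨p, hp, ⟨h, hfp⟩, hpx⟩ := Polynomial.exists_prime_dvd_of_monic_of_aeval_eq_zero
    (α' P.x) _ P.f P.monic_f le_rfl hroot.1 hroot.isUnit_derivative_f
  have : IsDomain (AdjoinRoot p) := AdjoinRoot.isDomain_of_prime hp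
  -- `L` is the function field of the component on which the given point lies. It remains to see
  -- that whatever vanishes in the field `L` vanishes in `S`.
  let L := FractionRing (AdjoinRoot p)
  let ξ : L := algebraMap (AdjoinRoot p) L (AdjoinRoot.root p)
  have hξ : ∀ g : Polynomial R, Polynomial.aeval ξ g = 0 → p ∣ g := by
    intro g hg
    rw [Polynomial.aeval_algebraMap_apply] at hg
    have := (FaithfulSMul.algebraMap_injective (AdjoinRoot p) L) (hg.trans (map_zero _).symm)
    rwa [AdjoinRoot.aeval_eq, AdjoinRoot.mk_eq_zero] at this
  have hm : P.HasMap ξ := by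
    constructor
    · rw [Polynomial.aeval_algebraMap_apply, AdjoinRoot.aeval_eq,
        AdjoinRoot.mk_eq_zero.2 ⟨h, hfp⟩, map_zero]
    · refine IsUnit.mk0 _ fun h0 => hroot.2.ne_zero ?_
      obtain ⟨k, hk⟩ := hξ _ h0
      rw [hk, map_mul, hpx, zero_mul]
  let θ : Localization.Away c →ₐ[R] L := (P.lift ξ hm).comp P.equivRing.toAlgHom
  have hθ : θ P.x = ξ := by simp [θ]
  have key : ∀ a : A, θ (algebraMap A _ a) = 0 → α a = 0 := by
    intro a ha
    -- Up to a power of the unit `P.g`, every element is a polynomial `F` in `x`. If it vanishes in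
    -- `L`, then `p` divides `F`, and `p` vanishes at the image of `x` in `S`.
    obtain ⟨F, n, hF⟩ := P.exists_mul_aeval_x_g_pow_eq_aeval_x (algebraMap A _ a)
    have h1 : Polynomial.aeval ξ F = 0 := by
      have := congrArg θ hF
      rw [map_mul, ha, zero_mul, ← Polynomial.aeval_algHom_apply, hθ] at this
      exact this.symm
    obtain ⟨k, hk⟩ := hξ F h1
    have h2 := congrArg α' hF
    rw [map_mul, hα', map_pow, ← Polynomial.aeval_algHom_apply, ← Polynomial.aeval_algHom_apply, hk,
      map_mul, hpx, zero_mul] at h2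
    exact ((hroot.2.pow n).mul_left_eq_zero).1 h2
  have := congrArg (fun z => θ (algebraMap A _ z)) hab
  simp only [map_mul, map_zero] at this
  exact (mul_eq_zero.1 this).imp (key a) (key b)

end NormalDomain

/-! ### Algebraicity over a reduced Noetherian ring. -/

section Algebraic

/-- The total ring of fractions of a reduced Noetherian ring is Artinian. -/
theorem FractionRing.isArtinianRing_of_isReduced (R : Type*) [CommRing R] [IsNoetherianRing R]
    [_root_.IsReduced R] : IsArtinianRing (FractionRing R) := by
  have hmin : ∀ P : Ideal R, P.IsPrime → Disjoint (nonZeroDivisors R : Set R) P →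
      P ∈ minimalPrimes R := by
    intro P hP hd
    -- In a reduced ring every zero divisor lies in a minimal prime; there are finitely many of
    -- these, so prime avoidance applies.
    have hsub : (P : Set R) ⊆ ⋃ p ∈ minimalPrimes R, (p : Set R) := by
      intro x hx
      have hx' : x ∉ nonZeroDivisors R := fun h => Set.disjoint_left.1 hd h hx
      rw [mem_nonZeroDivisors_iff_right] at hx'
      push Not at hx'
      obtain ⟨y, hy, hy0⟩ := hx'
      refine Ideal.iUnion_minimalPrimes.superset ⟨y, ?_, 1, ?_⟩
      · change y ∉ nilradical R
        rwa [nilradical_eq_zero]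
      · rw [pow_one, mul_comm, hy]
        exact zero_mem _
    obtain ⟨p, hp, hle⟩ := (Ideal.subset_union_prime_finite
      (minimalPrimes.finite_of_isNoetherianRing R) (f := id) ⊥ ⊥
      (fun p hp _ _ => Ideal.IsMinimalPrime.isPrime hp)).1 (by simpa using hsub)
    have := (hp.2 ⟨hP, bot_le⟩ hle).antisymm hle
    exact (show p = P from this) ▸ hp
  have : IsNoetherianRing (FractionRing R) :=
    IsLocalization.isNoetherianRing (nonZeroDivisors R) _ inferInstance
  have : Ring.KrullDimLE 0 (FractionRing R) := by
    rw [Ring.krullDimLE_zero_iff]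
    intro I hI
    obtain ⟨M, hM, hIM⟩ := Ideal.exists_le_maximal I hI.ne_top
    have hIp := (IsLocalization.isPrime_iff_isPrime_disjoint (nonZeroDivisors R) _ I).1 hI
    have hMp := (IsLocalization.isPrime_iff_isPrime_disjoint (nonZeroDivisors R) _ M).1 hM.isPrime
    have h1 := (hmin _ hMp.1 hMp.2).2 ⟨hIp.1, bot_le⟩ (Ideal.comap_mono hIM)
    have h2 : M ≤ I := by
      rw [← IsLocalization.map_under (nonZeroDivisors R) _ M,
        ← IsLocalization.map_under (nonZeroDivisors R) _ I]
      exact Ideal.map_mono h1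
    rwa [hIM.antisymm h2]
  exact IsNoetherianRing.isArtinianRing_of_krullDimLE_zero

/-- The elements of a flat quasi-finite algebra over a reduced Noetherian ring are algebraic. -/
theorem Algebra.QuasiFinite.exists_leadingCoeff_mem_nonZeroDivisors {R A : Type*} [CommRing R]
    [IsNoetherianRing R] [_root_.IsReduced R] [CommRing A] [Algebra R A] [Algebra.QuasiFinite R A]
    [Module.Flat R A] (a : A) :
    ∃ p : Polynomial R, p.leadingCoeff ∈ nonZeroDivisors R ∧ Polynomial.aeval a p = 0 := by
  have := FractionRing.isArtinianRing_of_isReduced R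
  let Q := FractionRing R
  -- Quasi-finite over an Artinian ring is finite, so `1 ⊗ a` is integral over `Q`. Clearing
  -- denominators in a monic equation makes the denominator `b` the leading coefficient, and
  -- flatness brings the equation back to `A`.
  have : Module.Finite Q (Q ⊗[R] A) := Module.Finite.of_quasiFinite
  have hinj : Function.Injective (algebraMap R Q) := IsLocalization.injective _ le_rfl
  obtain ⟨p, hp, hpa⟩ := Algebra.IsIntegral.isIntegral (R := Q) ((1 : Q) ⊗ₜ[R] a)
  obtain ⟨b, hbM, hb⟩ := IsLocalization.integerNormalization_spec (nonZeroDivisors R) p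
  set q := IsLocalization.integerNormalization (nonZeroDivisors R) p with hq
  refine ⟨q, ?_, ?_⟩
  · rcases subsingleton_or_nontrivial R with h | h
    · rw [Subsingleton.elim q.leadingCoeff 1]
      exact one_mem _
    have : Nontrivial Q := hinj.nontrivial
    have hlc : algebraMap R Q q.leadingCoeff = algebraMap R Q b := by
      rw [← Polynomial.leadingCoeff_map_of_injective hinj, hb, Algebra.smul_def,
        Polynomial.algebraMap_apply, Polynomial.leadingCoeff_mul_monic hp]
      simp
    rw [hinj hlc]
    exact hbM
  · have hA : Function.Injective (Algebra.TensorProduct.includeRight : A →ₐ[R] Q ⊗[R] A) :=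
      Algebra.TensorProduct.includeRight_injective hinj
    apply hA
    rw [map_zero, ← Polynomial.aeval_algHom_apply, ← Polynomial.aeval_map_algebraMap Q, hb]
    rw [Algebra.TensorProduct.includeRight_apply]
    have : Polynomial.aeval ((1 : Q) ⊗ₜ[R] a) p = 0 := hpa
    rw [Algebra.smul_def, map_mul, this, mul_zero]

end Algebraic

/-! ### Colimits of pointed étale algebras. -/

/-- A local homomorphism that factors through a flat algebra is injective on the base. -/
theorem Module.Flat.algebraMap_injective_of_isLocalHom {R A S : Type*} [CommRing R] [IsLocalRing R]
    [CommRing A] [Algebra R A] [Module.Flat R A] [CommRing S] [IsLocalRing S] [Algebra R S]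
    [IsLocalHom (algebraMap R S)] (α : A →ₐ[R] S) : Function.Injective (algebraMap R A) := by
  have : Module.FaithfullyFlat R A := by
    refine Module.FaithfullyFlat.iff_flat_and_proper_ideal R A |>.2 ⟨inferInstance, fun I hI h => ?_⟩
    have h1 : (1 : A) ∈ I.map (algebraMap R A) := by
      have h1 : (1 : A) ∈ I • (⊤ : Submodule R A) := by rw [h]; trivial
      rwa [Ideal.smul_top_eq_map] at h1
    -- A proper ideal of `R` lands in the maximal ideal of `S`, so it cannot generate the unit ideal
    -- of `A`; flatness thus becomes faithful flatness.
    have h2 : I.map (algebraMap R A) ≤ (maximalIdeal S).comap α := by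
      rw [Ideal.map_le_iff_le_comap]
      intro r hr
      have : r ∈ maximalIdeal R := le_maximalIdeal hI hr
      rw [Ideal.mem_comap, Ideal.mem_comap, AlgHom.commutes]
      exact (map_mem_nonunits_iff (algebraMap R S) r).2 this
    have := h2 h1
    rw [Ideal.mem_comap, map_one] at this
    exact (Ideal.ne_top_iff_one _).1 (maximalIdeal.isMaximal S).ne_top this
  exact FaithfulSMul.algebraMap_injective R A

/-- `ε : S → K` presents `S` as the filtered colimit of the étale `R`-algebras equipped with a
`K`-valued point. -/
structure IsEtaleColimit {R S K : Type u} [CommRing R] [CommRing S] [Field K] [Algebra R S]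
    [Algebra R K] (ε : S →ₐ[R] K) : Prop where
  surjective : Function.Surjective (algebraMap R K)
  isUnit_of_ne_zero : ∀ s, ε s ≠ 0 → IsUnit s
  exists_rep : ∀ s : S, ∃ (A : Type u) (_ : CommRing A) (_ : Algebra R A) (_ : Algebra.Etale R A)
    (α : A →ₐ[R] S) (a : A), α a = s
  exists_lift : ∀ (A : Type u) [CommRing A] [Algebra R A] [Algebra.Etale R A] (ψ : A →ₐ[R] K),
    ∃ α : A →ₐ[R] S, ε.comp α = ψ ∧ ∀ a, α a = 0 → ∃ (A' : Type u) (_ : CommRing A')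
      (_ : Algebra R A') (_ : Algebra.Etale R A') (β : A →ₐ[R] A') (α' : A' →ₐ[R] S),
        α'.comp β = α ∧ β a = 0

namespace IsEtaleColimit

variable {R S K : Type u} [CommRing R] [CommRing S] [Field K] [Algebra R S] [Algebra R K]
  {ε : S →ₐ[R] K}

theorem isLocalHom (h : IsEtaleColimit ε) : IsLocalHom ε :=
  ⟨fun s hs => h.isUnit_of_ne_zero s hs.ne_zero⟩

theorem isLocalRing (h : IsEtaleColimit ε) : IsLocalRing S :=
  have : IsLocalHom (ε : S →+* K) := ⟨h.isLocalHom.1⟩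
  RingHom.domain_isLocalRing (ε : S →+* K)

theorem mem_maximalIdeal_iff (h : IsEtaleColimit ε) [IsLocalRing S] {s : S} :
    s ∈ maximalIdeal S ↔ ε s = 0 := by
  rw [mem_maximalIdeal, mem_nonunits_iff, not_iff_comm]
  exact ⟨h.isUnit_of_ne_zero s, fun hs => (hs.map ε).ne_zero⟩

/-- Rigidity applied to `S`, whose maximal ideal is the kernel of `ε`: an `S`-valued point of an
étale algebra is determined by its `K`-valued point. -/
theorem algHom_ext (h : IsEtaleColimit ε) {A : Type*} [CommRing A] [Algebra R A]
    [Algebra.Etale R A] {α β : A →ₐ[R] S} (hαβ : ∀ a, ε (β a) = ε (α a)) : α = β := by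
  have := h.isLocalRing
  refine Algebra.FormallyUnramified.algHom_ext_of_sub_mem fun a => ?_
  rw [h.mem_maximalIdeal_iff, map_sub, hαβ, sub_self]

/-- By rigidity `α` is the very map that `exists_lift` provides for `ε.comp α`, so the vanishing
clause there holds for every `α`. -/
theorem exists_kill (h : IsEtaleColimit ε) (A : Type u) [CommRing A] [Algebra R A]
    [Algebra.Etale R A] (α : A →ₐ[R] S) (a : A) (ha : α a = 0) :
    ∃ (A' : Type u) (_ : CommRing A') (_ : Algebra R A') (_ : Algebra.Etale R A')
      (β : A →ₐ[R] A') (α' : A' →ₐ[R] S), α'.comp β = α ∧ β a = 0 := by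
  obtain ⟨α₁, hα₁, hkill⟩ := h.exists_lift A (ε.comp α)
  obtain rfl : α₁ = α := h.algHom_ext fun x => (congrArg (fun f => f x) hα₁).symm
  exact hkill a ha

/-- Tensor products of étale algebras are étale, so finitely many elements share one stage. -/
theorem exists_rep_finset (h : IsEtaleColimit ε) (T : Finset S) :
    ∃ (A : Type u) (_ : CommRing A) (_ : Algebra R A) (_ : Algebra.Etale R A) (α : A →ₐ[R] S),
      ∀ s ∈ T, s ∈ α.range := by
  classical
  induction T using Finset.induction_on with
  | empty => exact ⟨R, _, _, inferInstance, Algebra.ofId R S, by simp⟩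
  | insert t T ht ih =>
    obtain ⟨A, _, _, _, α, hα⟩ := ih
    obtain ⟨B, _, _, _, β, b, hb⟩ := h.exists_rep t
    have : Algebra.Etale R (A ⊗[R] B) := Algebra.Etale.comp R A _
    refine ⟨A ⊗[R] B, _, _, this,
      Algebra.TensorProduct.lift α β (fun _ _ => Commute.all _ _), fun s hs => ?_⟩
    rcases Finset.mem_insert.1 hs with rfl | hs
    · exact ⟨1 ⊗ₜ b, by simp [hb]⟩
    · obtain ⟨a, ha⟩ := hα s hs
      exact ⟨a ⊗ₜ 1, by simpa using ha⟩

/-- The coefficients of `F` come from one étale algebra `A`. Adjoining to `A` a universal simple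
root of the lifted polynomial `G` gives another étale `R`-algebra, which the approximate root equips
with a `K`-point. Lifting this point to `S` yields the root. -/
theorem henselianLocalRing (h : IsEtaleColimit ε) : HenselianLocalRing S := by
  have := h.isLocalRing
  refine ⟨fun F hF a₀ h0 h1 => ?_⟩
  obtain ⟨A, _, _, _, α, hα⟩ := h.exists_rep_finset F.coeffs
  obtain ⟨G, hGF, -, hG⟩ := Polynomial.lifts_and_natDegree_eq_and_monic (f := (α : A →+* S))
    ((Polynomial.lifts_iff_coeff_lifts F).2 fun n => by
      by_cases hn : F.coeff n = 0
      · exact ⟨0, by rw [hn, map_zero]⟩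
      · exact hα _ (Polynomial.coeff_mem_coeffs hn)) hF
  -- Here the inverted element is `G'` itself, so the required identity is `G' * 1 + G * 0 = G' ^
  -- 1`.
  let P : StandardEtalePair A := ⟨G, hG, Polynomial.derivative G, 1, 0, 1, by ring⟩
  let : Algebra R P.Ring := ((algebraMap A P.Ring).comp (algebraMap R A)).toAlgebra
  have : IsScalarTower R A P.Ring := IsScalarTower.of_algebraMap_eq' rfl
  have : Algebra.Etale R P.Ring := Algebra.Etale.comp R A _
  let : Algebra A S := (α : A →+* S).toAlgebra
  have : IsScalarTower R A S := IsScalarTower.of_algebraMap_eq' α.comp_algebraMap.symm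
  let : Algebra A K := ((ε.comp α : A →ₐ[R] K) : A →+* K).toAlgebra
  have : IsScalarTower R A K := IsScalarTower.of_algebraMap_eq' (ε.comp α).comp_algebraMap.symm
  let εA : S →ₐ[A] K := { ε with commutes' := fun _ => rfl }
  have hev : ∀ (g : Polynomial A) (x : S),
      Polynomial.aeval x g = (g.map (α : A →+* S)).eval x := fun g x => by
    rw [Polynomial.eval_map]; rfl
  have hm : P.HasMap (εA a₀) := by
    constructor
    · rw [Polynomial.aeval_algHom_apply, hev, hGF]
      exact h.mem_maximalIdeal_iff.1 h0
    · rw [Polynomial.aeval_algHom_apply, hev, show P.g = Polynomial.derivative G from rfl,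
        ← Polynomial.derivative_map, hGF]
      exact h1.map εA
  obtain ⟨θ, hθ, -⟩ := h.exists_lift P.Ring ((P.lift _ hm).restrictScalars R)
  have hθ' : ∀ x, ε (θ x) = P.lift _ hm x := fun x => congrArg (fun f => f x) hθ
  -- The lift `θ` is only known to be `R`-linear; rigidity makes it compatible with `α`, so that it
  -- sends `G` to `F`.
  have hθα : θ.comp (IsScalarTower.toAlgHom R A P.Ring) = α := by
    refine h.algHom_ext fun a => ?_
    rw [AlgHom.comp_apply, IsScalarTower.coe_toAlgHom', hθ', AlgHom.commutes]
    rfl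
  let θA : P.Ring →ₐ[A] S := { θ with commutes' := fun a => congrArg (fun f => f a) hθα }
  refine ⟨θA P.X, ?_, ?_⟩
  · have := congrArg θA P.hasMap_X.1
    rwa [map_zero, ← Polynomial.aeval_algHom_apply, hev, hGF] at this
  · rw [h.mem_maximalIdeal_iff, map_sub, sub_eq_zero]
    exact (hθ' _).trans (P.lift_X _ hm)

/-- If `R → K` is surjective and its kernel is contained in the maximal ideal of a local ring `B`
over `R`, then the residue field of `B` is an extension of `K`. -/
theorem nonempty_algHom_residueField (h : IsEtaleColimit ε) {B : Type w} [CommRing B]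
    [IsLocalRing B] [Algebra R B]
    (hB : ∀ r, algebraMap R K r = 0 → algebraMap R B r ∈ maximalIdeal B) :
    Nonempty (K →ₐ[R] ResidueField B) := by
  let κ : K →+* ResidueField B := (algebraMap R K).liftOfSurjective h.surjective
    ⟨algebraMap R (ResidueField B), fun r hr => (residue_eq_zero_iff _).2 (hB r hr)⟩
  exact ⟨{ κ with commutes' := fun r => RingHom.liftOfRightInverse_comp_apply _ _ _ _ _ }⟩

/-- As `R → K` is onto, `s` differs from a scalar by an element of the maximal ideal, and `f` is
local. So the residue of `f s` does not depend on `f`. -/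
theorem residue_eq (h : IsEtaleColimit ε) {B : Type w} [CommRing B] [IsLocalRing B] [Algebra R B]
    (κ : K →ₐ[R] ResidueField B) (f : S →ₐ[R] B) [IsLocalHom f] (s : S) :
    residue B (f s) = κ (ε s) := by
  obtain ⟨r, hr⟩ := h.surjective (ε s)
  have h0 : ε (s - algebraMap R S r) = 0 := by rw [map_sub, AlgHom.commutes, hr, sub_self]
  have h1 : f (s - algebraMap R S r) ∈ maximalIdeal B := fun hu =>
    ((isUnit_of_map_unit f _ hu).map ε).ne_zero h0
  rw [map_sub, AlgHom.commutes, ← residue_eq_zero_iff, map_sub, sub_eq_zero] at h1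
  rw [h1, ← hr, AlgHom.commutes]
  rfl

/-- The graph of the homomorphism from `S` to a Henselian local ring with the residue map `κ`. -/
def LiftGraph (ε : S →ₐ[R] K) {B : Type w} [CommRing B] [IsLocalRing B] [Algebra R B]
    (κ : K →ₐ[R] ResidueField B) (s : S) (b : B) : Prop :=
  ∃ (A : Type u) (_ : CommRing A) (_ : Algebra R A) (_ : Algebra.Etale R A) (α : A →ₐ[R] S)
    (χ : A →ₐ[R] B) (a : A), (∀ x, residue B (χ x) = κ (ε (α x))) ∧ α a = s ∧ χ a = b

namespace LiftGraph

variable {B : Type w} [CommRing B] [Algebra R B]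

/-- Passing to a tensor product puts two points of the graph on one étale algebra, where they can be
added and multiplied. -/
theorem common [IsLocalRing B] {κ : K →ₐ[R] ResidueField B} {s s' : S} {b b' : B}
    (hb : LiftGraph ε κ s b) (hb' : LiftGraph ε κ s' b') :
    ∃ (A : Type u) (_ : CommRing A) (_ : Algebra R A) (_ : Algebra.Etale R A) (α : A →ₐ[R] S)
      (χ : A →ₐ[R] B) (a a' : A), (∀ x, residue B (χ x) = κ (ε (α x))) ∧
        (α a = s ∧ χ a = b) ∧ (α a' = s' ∧ χ a' = b') := by
  obtain ⟨A, _, _, _, α, χ, a, hχ, ha, ha'⟩ := hb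
  obtain ⟨A₂, _, _, _, α₂, χ₂, a₂, hχ₂, ha₂, ha₂'⟩ := hb'
  have : Algebra.Etale R (A ⊗[R] A₂) := Algebra.Etale.comp R A _
  refine ⟨A ⊗[R] A₂, _, _, this, Algebra.TensorProduct.lift α α₂ (fun _ _ => Commute.all _ _),
    Algebra.TensorProduct.lift χ χ₂ (fun _ _ => Commute.all _ _), a ⊗ₜ 1, 1 ⊗ₜ a₂,
    fun x => ?_, by simp [ha, ha'], by simp [ha₂, ha₂']⟩
  induction x with
  | zero => simp
  | add x y hx hy => simp only [map_add, hx, hy]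
  | tmul x y => simp [hχ, hχ₂]

theorem exists_of_henselian [HenselianLocalRing B] (h : IsEtaleColimit ε)
    (κ : K →ₐ[R] ResidueField B) (s : S) : ∃ b, LiftGraph ε κ s b := by
  obtain ⟨A, _, _, _, α, a, rfl⟩ := h.exists_rep s
  obtain ⟨χ, hχ⟩ := HenselianLocalRing.exists_algHom ((κ.comp ε).comp α)
  exact ⟨χ a, A, _, _, inferInstance, α, χ, a, hχ, rfl, rfl⟩

/-- The difference `a - a'` dies in a further étale algebra `A'`. The point of `A'` lifts to `B`,
and by rigidity this lift restricts to `χ`, so `χ` kills the difference too. -/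
theorem unique [HenselianLocalRing B] (h : IsEtaleColimit ε) {κ : K →ₐ[R] ResidueField B} {s : S}
    {b b' : B} (hb : LiftGraph ε κ s b) (hb' : LiftGraph ε κ s b') : b = b' := by
  obtain ⟨A, _, _, _, α, χ, a, a', hχ, ⟨ha, rfl⟩, ⟨ha', rfl⟩⟩ := hb.common hb'
  obtain ⟨A', _, _, _, β, α', hα', hβ⟩ := h.exists_kill A α (a - a')
    (by rw [map_sub, ha, ha', sub_self])
  obtain ⟨χ', hχ'⟩ := HenselianLocalRing.exists_algHom ((κ.comp ε).comp α')
  have : χ'.comp β = χ := Algebra.FormallyUnramified.algHom_ext_of_sub_mem fun x => by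
    rw [← residue_eq_zero_iff, map_sub, AlgHom.comp_apply, hχ, hχ', ← hα']
    exact sub_self _
  rw [← sub_eq_zero, ← map_sub, ← this, AlgHom.comp_apply, hβ, map_zero]

end LiftGraph

/-- A filtered colimit of étale algebras maps uniquely to each Henselian local ring. -/
theorem existsUnique_algHom (h : IsEtaleColimit ε) (B : Type w) [CommRing B] [HenselianLocalRing B]
    [Algebra R B] (hB : ∀ r, algebraMap R K r = 0 → algebraMap R B r ∈ maximalIdeal B) :
    ∃! f : S →ₐ[R] B, IsLocalHom f := by
  obtain ⟨κ⟩ := h.nonempty_algHom_residueField hB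
  -- A pointwise choice suffices: the graph is single-valued, which forces compatibility with the
  -- ring operations.
  choose f hf using LiftGraph.exists_of_henselian h κ
  have hadd : ∀ s s', f (s + s') = f s + f s' := fun s s' => by
    obtain ⟨A, _, _, _, α, χ, a, a', hχ, ⟨ha, hb⟩, ⟨ha', hb'⟩⟩ := (hf s).common (hf s')
    exact (hf _).unique h ⟨A, _, _, inferInstance, α, χ, a + a', hχ, by rw [map_add, ha, ha'],
      by rw [map_add, hb, hb']⟩
  have hmul : ∀ s s', f (s * s') = f s * f s' := fun s s' => by
    obtain ⟨A, _, _, _, α, χ, a, a', hχ, ⟨ha, hb⟩, ⟨ha', hb'⟩⟩ := (hf s).common (hf s')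
    exact (hf _).unique h ⟨A, _, _, inferInstance, α, χ, a * a', hχ, by rw [map_mul, ha, ha'],
      by rw [map_mul, hb, hb']⟩
  have halg : ∀ r, f (algebraMap R S r) = algebraMap R B r := fun r =>
    (hf _).unique h ⟨R, _, _, inferInstance, Algebra.ofId R S, Algebra.ofId R B, r, fun x => by
      rw [Algebra.ofId_apply, Algebra.ofId_apply, AlgHom.commutes, AlgHom.commutes]; rfl, rfl, rfl⟩
  let F : S →ₐ[R] B :=
    { toFun := f
      map_one' := by simpa using halg 1
      map_zero' := by simpa using halg 0
      map_add' := hadd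
      map_mul' := hmul
      commutes' := halg }
  refine ⟨F, ⟨fun s hs => h.isUnit_of_ne_zero s fun h0 => ?_⟩, fun G hG => ?_⟩
  · obtain ⟨A, _, _, _, α, χ, a, hχ, ha, hb⟩ := hf s
    have := hχ a
    rw [ha, hb, h0, map_zero, residue_eq_zero_iff] at this
    exact this hs
  · ext s
    obtain ⟨A, _, _, _, α, a, rfl⟩ := h.exists_rep s
    obtain ⟨χ, hχ⟩ := HenselianLocalRing.exists_algHom ((κ.comp ε).comp α)
    have : G.comp α = χ := Algebra.FormallyUnramified.algHom_ext_of_sub_mem fun x => by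
      rw [← residue_eq_zero_iff, map_sub, hχ, sub_eq_zero]
      exact (h.residue_eq κ G _).symm
    exact (hf _).unique h ⟨A, _, _, inferInstance, α, χ, a, hχ, rfl, by rw [← this]; rfl⟩ |>.symm

/-- Since `ρ` is not assumed local, `ε ∘ ρ ∘ α` might be another `K`-point of `A` than `ε ∘ α`. But
the separating function `b` is `1` at the latter, so `α b` is a unit and `b` is nonzero at the
former as well. Hence the points agree, and rigidity applies. -/
theorem algHom_eq_id (h : IsEtaleColimit ε) (ρ : S →ₐ[R] S) (s : S) : ρ s = s := by
  obtain ⟨A, _, _, _, α, a, rfl⟩ := h.exists_rep s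
  obtain ⟨b, hb, hb'⟩ := Algebra.FormallyUnramified.exists_separating h.surjective (ε.comp α)
  have hu : IsUnit (α b) := h.isUnit_of_ne_zero _ (by
    rw [← AlgHom.comp_apply, hb]; exact one_ne_zero)
  have hne : (ε.comp (ρ.comp α)) b ≠ 0 := ((hu.map ρ).map ε).ne_zero
  have : α = ρ.comp α := h.algHom_ext fun x =>
    sub_eq_zero.1 ((mul_eq_zero.1 (hb' (ε.comp (ρ.comp α)) x)).resolve_right hne)
  exact (congrArg (fun f => f a) this).symm

/-- The universal map `S → T` followed by the inclusion is an endomorphism of `S`, hence the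
identity. The inclusion need not be known to be local. -/
theorem subalgebra_eq_top (h : IsEtaleColimit ε) (T : Subalgebra R S) [HenselianLocalRing T] :
    T = ⊤ := by
  obtain ⟨f, -, -⟩ := h.existsUnique_algHom T fun r hr hu => by
    have := ((hu.map T.val).map ε).ne_zero
    rw [AlgHom.commutes, AlgHom.commutes] at this
    exact this hr
  refine eq_top_iff.2 fun s _ => ?_
  rw [← h.algHom_eq_id (T.val.comp f) s]
  exact (f s).2

theorem exists_leadingCoeff_mem_nonZeroDivisors [IsNoetherianRing R] [_root_.IsReduced R]
    (h : IsEtaleColimit ε) (s : S) :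
    ∃ p : Polynomial R, p.leadingCoeff ∈ nonZeroDivisors R ∧ Polynomial.aeval s p = 0 := by
  obtain ⟨A, _, _, _, α, a, rfl⟩ := h.exists_rep s
  obtain ⟨p, hp, hpa⟩ := Algebra.QuasiFinite.exists_leadingCoeff_mem_nonZeroDivisors (R := R) a
  exact ⟨p, hp, by rw [Polynomial.aeval_algHom_apply, hpa, map_zero]⟩

/-! ### From `R` to its localisation `O` at the point. -/

section Localization

variable {O : Type u} [CommRing O] [Algebra R O] [Algebra O S] [IsScalarTower R O S]

theorem isLocalHom_algebraMap (ε : S →ₐ[R] K) (p : Ideal R) [p.IsPrime]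
    [IsLocalization.AtPrime O p] (hp : p = RingHom.ker (algebraMap R K)) :
    IsLocalHom (algebraMap O S) := by
  refine ⟨fun o ho => ?_⟩
  obtain ⟨⟨r, u⟩, hr⟩ := IsLocalization.surj p.primeCompl o
  have hu : algebraMap R K u ≠ 0 := fun h0 => u.2 (hp ▸ h0)
  have h1 : ε (algebraMap O S o) * algebraMap R K u = algebraMap R K r := by
    rw [← AlgHom.commutes ε, ← AlgHom.commutes ε, IsScalarTower.algebraMap_apply R O S,
      IsScalarTower.algebraMap_apply R O S, ← map_mul, ← map_mul, hr]
  have h2 : r ∈ p.primeCompl := fun hrp => by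
    have hr0 : r ∈ p := hrp
    rw [hp] at hr0
    exact mul_ne_zero (ho.map ε).ne_zero hu (h1.trans hr0)
  have h3 := IsLocalization.map_units O (⟨r, h2⟩ : p.primeCompl)
  rw [← hr] at h3
  exact isUnit_of_mul_isUnit_left h3

/-- An étale `R`-algebra over `S` can be replaced by an étale algebra over a localization. -/
abbrev baseChangeHom (O : Type u) [CommRing O] [Algebra R O] [Algebra O S] [IsScalarTower R O S]
    {A : Type u} [CommRing A] [Algebra R A] (α : A →ₐ[R] S) : O ⊗[R] A →ₐ[O] S :=
  Algebra.TensorProduct.lift (Algebra.ofId O S) α (fun _ _ => Commute.all _ _)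

/-- If `r / u` dies in `S`, then `r` already dies in some étale `A`. The flat map `O → O ⊗ A` is
injective because `O → S` is local and factors through it, so `r` is zero in `O`. -/
theorem algebraMap_injective (h : IsEtaleColimit ε) (p : Ideal R) [p.IsPrime]
    [IsLocalization.AtPrime O p] (hp : p = RingHom.ker (algebraMap R K)) :
    Function.Injective (algebraMap O S) := by
  have := h.isLocalRing
  have := isLocalHom_algebraMap (O := O) ε p hp
  have := IsLocalization.AtPrime.isLocalRing O p
  refine (injective_iff_map_eq_zero _).2 fun o ho => ?_
  obtain ⟨⟨r, u⟩, hr⟩ := IsLocalization.surj p.primeCompl o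
  have h0 : Algebra.ofId R S r = 0 := by
    rw [Algebra.ofId_apply, IsScalarTower.algebraMap_apply R O S, ← hr, map_mul, ho, zero_mul]
  obtain ⟨A, _, _, _, β, α, -, hβ⟩ := h.exists_kill R (Algebra.ofId R S) r h0
  have hβ' : algebraMap R A r = 0 := by rw [← hβ, ← AlgHom.commutes β]; rfl
  have hinj := Module.Flat.algebraMap_injective_of_isLocalHom (baseChangeHom O α)
  have h1 : algebraMap R O r = 0 := hinj (by
    rw [map_zero, ← IsScalarTower.algebraMap_apply,
      ← AlgHom.commutes (Algebra.TensorProduct.includeRight : A →ₐ[R] O ⊗[R] A), hβ', map_zero])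
  rw [← hr] at h1
  exact ((IsLocalization.map_units O u).mul_left_eq_zero).1 h1

/-- A vanishing product in `S` already vanishes at a finite stage. After base change this stage is
étale over the normal domain `O`, so one factor dies in the local ring `S`. -/
theorem isDomain (h : IsEtaleColimit ε) [IsDomain O] [IsIntegrallyClosed O] : IsDomain S := by
  have := h.isLocalRing
  have : NoZeroDivisors S := by
    refine ⟨fun {s s'} hss => ?_⟩
    classical
    obtain ⟨A, _, _, _, α, hα⟩ := h.exists_rep_finset {s, s'}
    obtain ⟨a, rfl⟩ := hα s (by simp)
    obtain ⟨a', rfl⟩ := hα s' (by simp)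
    change α a * α a' = 0 at hss
    obtain ⟨A', _, _, _, β, α', rfl, hβ⟩ := h.exists_kill A α (a * a') (by rw [map_mul, hss])
    have h0 : ((1 : O) ⊗ₜ[R] β a) * ((1 : O) ⊗ₜ[R] β a') = 0 := by
      rw [Algebra.TensorProduct.tmul_mul_tmul, ← map_mul, hβ, TensorProduct.tmul_zero]
    simpa using Algebra.Etale.eq_zero_or_eq_zero_of_mul_eq_zero (baseChangeHom O α') h0
  exact NoZeroDivisors.to_isDomain S

theorem exists_leadingCoeff_mem_nonZeroDivisors_localization [IsNoetherianRing R]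
    [_root_.IsReduced R] (h : IsEtaleColimit ε) (p : Ideal R) [p.IsPrime]
    [IsLocalization.AtPrime O p] (s : S) :
    ∃ q : Polynomial O, q.leadingCoeff ∈ nonZeroDivisors O ∧ Polynomial.aeval s q = 0 := by
  have := IsLocalization.AtPrime.isLocalRing O p
  obtain ⟨q, hq, hqs⟩ := h.exists_leadingCoeff_mem_nonZeroDivisors s
  have hmem : algebraMap R O q.leadingCoeff ∈ nonZeroDivisors O :=
    IsLocalization.map_nonZeroDivisors_le p.primeCompl O ⟨_, hq, rfl⟩
  refine ⟨q.map (algebraMap R O), ?_, by rwa [Polynomial.aeval_map_algebraMap]⟩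
  rwa [Polynomial.leadingCoeff_map_of_leadingCoeff_ne_zero _ (nonZeroDivisors.ne_zero hmem)]

theorem isHenselisation (h : IsEtaleColimit ε) [IsLocalRing O] (p : Ideal R) [p.IsPrime]
    [IsLocalization.AtPrime O p] (hp : p = RingHom.ker (algebraMap R K)) :
    IsHenselisation.{u, u, w} (algebraMap O S) where
  henselian := h.henselianLocalRing
  isLocalHom := isLocalHom_algebraMap ε p hp
  existsUnique_lift B _ _ g _ := by
    let : Algebra R B := (g.comp (algebraMap R O)).toAlgebra
    obtain ⟨f, hf, hu⟩ := h.existsUnique_algHom B fun r hr hu => by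
      have h1 : IsUnit (algebraMap R O r) := isUnit_of_map_unit g _ hu
      have h2 : r ∈ p := by rw [hp]; exact hr
      exact (IsLocalization.AtPrime.isUnit_to_map_iff O p r).1 h1 h2
    refine ⟨f, ⟨⟨hf.1⟩, ?_⟩, fun f' hf' => ?_⟩
    -- Maps out of the localisation `O` are determined on `R`, over which the universal property was
    -- proved.
    · refine IsLocalization.ringHom_ext p.primeCompl (RingHom.ext fun r => ?_)
      change f (algebraMap O S (algebraMap R O r)) = _
      rw [← IsScalarTower.algebraMap_apply, AlgHom.commutes]
      rfl
    · let F : S →ₐ[R] B := { f' with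
        commutes' := fun r => by
          rw [IsScalarTower.algebraMap_apply R O S]
          exact congrArg (fun k => k (algebraMap R O r)) hf'.2 }
      have := hu F ⟨hf'.1.1⟩
      rw [← this]
      rfl

theorem isSmallestHenselian [IsNoetherianRing R] [_root_.IsReduced R] (h : IsEtaleColimit ε)
    (p : Ideal R) [p.IsPrime] [IsLocalization.AtPrime O p]
    (hp : p = RingHom.ker (algebraMap R K)) : IsSmallestHenselian (algebraMap O S) where
  henselian := h.henselianLocalRing
  injective := h.algebraMap_injective p hp
  algebraic := h.exists_leadingCoeff_mem_nonZeroDivisors_localization p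
  eq_top_of_henselian T hT _ := by
    let T' : Subalgebra R S :=
      { T with
        algebraMap_mem' := fun r => hT ⟨algebraMap R O r, by
          rw [← IsScalarTower.algebraMap_apply]⟩ }
    have : HenselianLocalRing T' := ‹_›
    have := h.subalgebra_eq_top T'
    refine eq_top_iff.2 fun s _ => ?_
    change s ∈ T'
    rw [this]
    trivial

end Localization

end IsEtaleColimit

/-! ### Embedding in the algebraic closure. -/

section Embedding

variable {R S : Type u} [CommRing R] [CommRing S] [IsDomain S] [Algebra R S]

/-- A nonzero algebraic element of a domain divides a nonzero scalar, and scalars survive in `B`. -/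
theorem Algebra.IsAlgebraic.injective_of_isDomain [Algebra.IsAlgebraic R S] {B : Type*} [CommRing B]
    [Algebra R B] [FaithfulSMul R B] (f : S →ₐ[R] B) : Function.Injective f := by
  refine (injective_iff_map_eq_zero _).2 fun s hs => ?_
  by_contra h0
  obtain ⟨r, hr, t, ht⟩ := (Algebra.IsAlgebraic.isAlgebraic (R := R) s).exists_nonzero_dvd
    (mem_nonZeroDivisors_of_ne_zero h0)
  have := congrArg f ht
  rw [AlgHom.commutes, map_mul, hs, zero_mul] at this
  exact hr (FaithfulSMul.algebraMap_injective R B (this.trans (map_zero _).symm))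

instance AlgebraicClosure.faithfulSMul_fractionRing [IsDomain R] :
    FaithfulSMul R (AlgebraicClosure (FractionRing R)) := by
  rw [faithfulSMul_iff_algebraMap_injective,
    IsScalarTower.algebraMap_eq R (FractionRing R) (AlgebraicClosure (FractionRing R))]
  exact (algebraMap (FractionRing R) _).injective.comp (IsFractionRing.injective R _)

/-- A Henselisation that is algebraic over a local domain is smallest among the Henselian rings in
the algebraic closure. -/
theorem IsHenselisation.isSmallestHenselianInClosure [IsDomain R] [IsLocalRing R]
    [Algebra.IsAlgebraic R S] [FaithfulSMul R S] (h : IsHenselisation.{u, u, u} (algebraMap R S)) :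
    IsSmallestHenselianInClosure (algebraMap R S) where
  exists_embedding := by
    let i : S →ₐ[R] AlgebraicClosure (FractionRing R) := IsAlgClosed.lift
    exact ⟨i, Algebra.IsAlgebraic.injective_of_isDomain i, i.comp_algebraMap⟩
  exists_embedding_le B _ _ := by
    obtain ⟨f, ⟨-, hf⟩, -⟩ := h.existsUnique_lift B (algebraMap R B)
    have : FaithfulSMul R B := (faithfulSMul_iff_algebraMap_injective R B).2
      (Function.Injective.of_comp (f := B.val)
        (FaithfulSMul.algebraMap_injective R (AlgebraicClosure (FractionRing R))))
    let F : S →ₐ[R] B := { f with commutes' := fun r => congrArg (fun k => k r) hf }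
    exact ⟨f, Algebra.IsAlgebraic.injective_of_isDomain F, hf⟩

end Embedding

end

/-! ### Étale neighbourhoods of a rational point. -/

noncomputable section

/-- A rational point `y` of a scheme `Y` locally of finite type over a field `K`. -/
structure RationalPoint (K : Type u) [Field K] (Y : Scheme.{u}) (y : Y) where
  /-- The structure morphism. -/
  str : Y ⟶ Spec (CommRingCat.of K)
  [locallyOfFiniteType : LocallyOfFiniteType str]
  /-- The morphism with image `y`. -/
  hom : Spec (CommRingCat.of K) ⟶ Y
  hom_str : hom ≫ str = 𝟙 _
  hom_apply : hom default = y

attribute [instance] RationalPoint.locallyOfFiniteType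

/-- A closed point of a variety over an algebraically closed field is rational. -/
def AlgVariety.rationalPoint {K : Type u} [Field K] [IsAlgClosed K] (Y : AlgVariety K)
    (y : Y.Point) : RationalPoint K Y.toScheme y.1 where
  str := Y.str
  hom := pointOfClosedPoint Y.str y.1 y.2
  hom_str := pointOfClosedPoint_comp _ _ _
  hom_apply := pointOfClosedPoint_apply _ _ _ _

namespace EtaleNhd

open Limits

section Geometric

variable {K : Type u} [Field K] [IsAlgClosed K] {Y : Scheme.{u}} {y : Y} (s : RationalPoint K Y y)

include s

theorem exists_point (U : EtaleNhd Y y) :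
    ∃ l : Spec (.of K) ⟶ U.left, l ≫ U.hom = s.hom ∧ l default = U.pt :=
  Scheme.exists_fac_of_etale_of_isSepClosed U.hom (s.hom) U.pt
    (by rw [U.map_pt, s.hom_apply])

/-- The geometric point of an étale neighbourhood. -/
def point (U : EtaleNhd Y y) : Spec (.of K) ⟶ U.left := (exists_point s U).choose

theorem point_hom (U : EtaleNhd Y y) : point s U ≫ U.hom = s.hom :=
  (exists_point s U).choose_spec.1

theorem point_apply (U : EtaleNhd Y y) (a) : point s U a = U.pt := by
  rw [Subsingleton.elim a default]
  exact (exists_point s U).choose_spec.2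

/-- Over an algebraically closed field, a `K`-point of a scheme locally of finite type is determined
by its image. -/
theorem eq_point (U : EtaleNhd Y y) (l : Spec (.of K) ⟶ U.left)
    (hl : l ≫ U.hom = s.hom) (hp : l default = U.pt) : l = point s U := by
  refine ext_of_apply_closedPoint_eq (U.hom ≫ s.str) ?_ ?_ ?_
  · rw [← Category.assoc, hl, s.hom_str]
  · rw [← Category.assoc, point_hom, s.hom_str]
  · exact (congrArg l (Subsingleton.elim _ _)).trans (hp.trans (point_apply s U _).symm)

theorem point_map {U V : EtaleNhd Y y} (g : U ⟶ V) :
    point s U ≫ Mor.map g = point s V := by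
  apply eq_point
  · rw [Category.assoc, g.comm, point_hom]
  · rw [Scheme.Hom.comp_apply, point_apply, g.map_pt]

/-- An étale neighbourhood given by an étale morphism and a lift of the geometric point. -/
def ofPoint {X : Scheme.{u}} (f : X ⟶ Y) [Etale f] [QuasiCompact f]
    (l : Spec (.of K) ⟶ X) (hl : l ≫ f = s.hom) : EtaleNhd Y y where
  left := X
  hom := f
  pt := l default
  map_pt := by rw [← Scheme.Hom.comp_apply, hl, s.hom_apply]

theorem point_ofPoint {X : Scheme.{u}} (f : X ⟶ Y) [Etale f] [QuasiCompact f]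
    (l : Spec (.of K) ⟶ X) (hl : l ≫ f = s.hom) : point s (ofPoint s f l hl) = l :=
  (eq_point s (ofPoint s f l hl) l hl rfl).symm

/-- A morphism of étale neighbourhoods given by a morphism compatible with geometric points. -/
def homOfPoint {U V : EtaleNhd Y y} (g : U.left ⟶ V.left) (hg : g ≫ V.hom = U.hom)
    (hp : point s U ≫ g = point s V) : U ⟶ V where
  map := g
  comm := hg
  map_pt := by rw [← point_apply s U default, ← Scheme.Hom.comp_apply, hp, point_apply]

omit s in
theorem isLocallyNoetherian_left [IsLocallyNoetherian Y] (U : EtaleNhd Y y) :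
    IsLocallyNoetherian U.left :=
  LocallyOfFiniteType.isLocallyNoetherian U.hom

/-- Two neighbourhoods are dominated by their fibre product. Two parallel morphisms are equalised on
the pullback of the diagonal of `V`, an open immersion because `V` is étale. The geometric points
supply the base points. -/
theorem isCofiltered : IsCofiltered (EtaleNhd Y y) where
  nonempty := ⟨ofPoint s (𝟙 _) (s.hom) (Category.comp_id _)⟩
  cone_objs U V := by
    let l : Spec (.of K) ⟶ pullback U.hom V.hom :=
      pullback.lift (point s U) (point s V) (by rw [point_hom, point_hom])
    let W : EtaleNhd Y y := ofPoint s (pullback.fst U.hom V.hom ≫ U.hom) l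
      (by rw [pullback.lift_fst_assoc, point_hom])
    refine ⟨W, homOfPoint s (pullback.fst U.hom V.hom) rfl ?_,
      homOfPoint s (pullback.snd U.hom V.hom) pullback.condition.symm ?_, trivial⟩
    · exact (congrArg (· ≫ _) (point_ofPoint s _ _ _)).trans (pullback.lift_fst _ _ _)
    · exact (congrArg (· ≫ _) (point_ofPoint s _ _ _)).trans (pullback.lift_snd _ _ _)
  cone_maps U V f g := by
    -- Noetherianity of `U` makes its open subscheme, the equaliser, quasi-compact over it.
    have := LocallyOfFiniteType.isLocallyNoetherian s.str
    have := isLocallyNoetherian_left U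
    let q : U.left ⟶ pullback V.hom V.hom :=
      pullback.lift (Mor.map f) (Mor.map g) (by rw [f.comm, g.comm])
    let l : Spec (.of K) ⟶ pullback q (pullback.diagonal V.hom) :=
      pullback.lift (point s U) (point s V) (by
        apply pullback.hom_ext
        · rw [Category.assoc, Category.assoc, pullback.lift_fst, pullback.diagonal_fst,
            Category.comp_id, point_map]
        · rw [Category.assoc, Category.assoc, pullback.lift_snd, pullback.diagonal_snd,
            Category.comp_id, point_map])
    let W : EtaleNhd Y y :=
      ofPoint s (pullback.fst q (pullback.diagonal V.hom) ≫ U.hom) l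
        (by rw [pullback.lift_fst_assoc, point_hom])
    refine ⟨W, homOfPoint s (pullback.fst q (pullback.diagonal V.hom)) rfl ?_, ?_⟩
    · exact (congrArg (· ≫ _) (point_ofPoint s _ _ _)).trans (pullback.lift_fst _ _ _)
    · have hc := pullback.condition (f := q) (g := pullback.diagonal V.hom)
      have h1 := congrArg (fun k => k ≫ pullback.fst V.hom V.hom) hc
      have h2 := congrArg (fun k => k ≫ pullback.snd V.hom V.hom) hc
      simp only [q, Category.assoc, pullback.lift_fst, pullback.lift_snd, pullback.diagonal_fst,
        pullback.diagonal_snd, Category.comp_id] at h1 h2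
      exact Mor.ext (h1.trans h2.symm)

end Geometric

/-! ### Cofinality of pointed étale algebras. -/

section Affine

variable {K : Type u} [Field K] [IsAlgClosed K] {Y : Scheme.{u}} {y : Y} (s : RationalPoint K Y y)

omit [IsAlgClosed K] in
theorem exists_lift_of_isOpenImmersion {X : Scheme.{u}} {x : X} (l : Spec (.of K) ⟶ X)
    (hl : l default = x) {V : X.Opens} (hV : IsAffineOpen V) (hx : x ∈ V) :
    ∃ ψ : Γ(X, V) ⟶ .of K, Spec.map ψ ≫ hV.fromSpec = l := by
  have hr : Set.range l ⊆ Set.range hV.fromSpec := by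
    rintro _ ⟨a, rfl⟩
    rw [hV.range_fromSpec, Subsingleton.elim a default, hl]
    exact hx
  exact ⟨Spec.preimage (IsOpenImmersion.lift hV.fromSpec l hr), by
    rw [Spec.map_preimage, IsOpenImmersion.lift_fac]⟩

variable [IsLocallyNoetherian Y] {W : Y.Opens} (hW : IsAffineOpen W) {χ : Γ(Y, W) ⟶ .of K}
  (hχ : Spec.map χ ≫ hW.fromSpec = s.hom)

/-- The étale neighbourhood given by an étale algebra over the coordinate ring of an affine open
subset and a rational point of this algebra. -/
def affine {A : CommRingCat.{u}} (φ : Γ(Y, W) ⟶ A) (hφ : φ.hom.Etale) (ψ : A ⟶ .of K)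
    (hψ : φ ≫ ψ = χ) : EtaleNhd Y y :=
  have : Etale (Spec.map φ) := (HasRingHomProperty.Spec_iff (P := @Etale)).2 hφ
  ofPoint s (Spec.map φ ≫ hW.fromSpec) (Spec.map ψ)
    (by rw [← Category.assoc, ← Spec.map_comp, hψ, hχ])

variable {A A' : CommRingCat.{u}} {φ : Γ(Y, W) ⟶ A} (hφ : φ.hom.Etale) {ψ : A ⟶ .of K}
  (hψ : φ ≫ ψ = χ) {φ' : Γ(Y, W) ⟶ A'} (hφ' : φ'.hom.Etale) {ψ' : A' ⟶ .of K}
  (hψ' : φ' ≫ ψ' = χ)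

theorem point_affine : point s (affine s hW hχ φ hφ ψ hψ) = Spec.map ψ :=
  have : Etale (Spec.map φ) := (HasRingHomProperty.Spec_iff (P := @Etale)).2 hφ
  point_ofPoint s (Spec.map φ ≫ hW.fromSpec) (Spec.map ψ)
    (by rw [← Category.assoc, ← Spec.map_comp, hψ, hχ])

/-- Homomorphisms of pointed étale algebras induce morphisms of étale neighbourhoods. -/
def affineHom (β : A ⟶ A') (hβ : φ ≫ β = φ') (hβψ : β ≫ ψ' = ψ) :
    affine s hW hχ φ' hφ' ψ' hψ' ⟶ affine s hW hχ φ hφ ψ hψ :=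
  homOfPoint s (Spec.map β : Spec A' ⟶ Spec A)
    (by
      change Spec.map β ≫ Spec.map φ ≫ hW.fromSpec = Spec.map φ' ≫ hW.fromSpec
      rw [← Category.assoc, ← Spec.map_comp, hβ])
    (by
      have h : Spec.map ψ' ≫ Spec.map β = Spec.map ψ := by rw [← Spec.map_comp, hβψ]
      exact (congrArg (· ≫ Spec.map β) (point_affine s hW hχ hφ' hψ')).trans
        (h.trans (point_affine s hW hχ hφ hψ).symm))

/-- Between affine neighbourhoods nothing but algebra maps occurs: compatibility over `W` holds
because `hW.fromSpec` is a monomorphism, compatibility at the points by uniqueness of the geometric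
point. -/
theorem exists_of_affine_hom (g : affine s hW hχ φ' hφ' ψ' hψ' ⟶ affine s hW hχ φ hφ ψ hψ) :
    ∃ β : A ⟶ A', Mor.map g = Spec.map β ∧ φ ≫ β = φ' ∧ β ≫ ψ' = ψ := by
  let m : Spec A' ⟶ Spec A := Mor.map g
  obtain ⟨β, hβ⟩ : ∃ β : A ⟶ A', m = Spec.map β := ⟨Spec.preimage m, (Spec.map_preimage m).symm⟩
  refine ⟨β, hβ, ?_, ?_⟩
  · have h : m ≫ Spec.map φ ≫ hW.fromSpec = Spec.map φ' ≫ hW.fromSpec := Mor.comm g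
    rw [hβ, ← Category.assoc, ← Spec.map_comp, cancel_mono] at h
    exact Spec.map_injective h
  · have h : (point s (affine s hW hχ φ' hφ' ψ' hψ') : Spec (.of K) ⟶ Spec A') ≫ m =
        point s (affine s hW hχ φ hφ ψ hψ) := point_map s g
    rw [hβ] at h
    have h' : Spec.map ψ' ≫ Spec.map β = Spec.map ψ :=
      (congrArg (· ≫ _) (point_affine s hW hχ hφ' hψ')).symm.trans
        (h.trans (point_affine s hW hχ hφ hψ))
    rw [← Spec.map_comp] at h'
    exact Spec.map_injective h'

/-- The étale neighbourhoods of `y` that are affine over an affine open neighbourhood of `y` are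
cofinal. -/
theorem exists_affine_hom (hy : y ∈ W) (U : EtaleNhd Y y) :
    ∃ (A : CommRingCat.{u}) (φ : Γ(Y, W) ⟶ A) (hφ : φ.hom.Etale) (ψ : A ⟶ .of K) (hψ : φ ≫ ψ = χ),
      Nonempty (affine s hW hχ φ hφ ψ hψ ⟶ U) := by
  have hU : U.pt ∈ U.hom ⁻¹ᵁ W := by
    change U.hom U.pt ∈ W
    rwa [U.map_pt]
  obtain ⟨V, hV, hxV, hVW'⟩ := exists_isAffineOpen_mem_and_subset hU
  have hVW : V ≤ U.hom ⁻¹ᵁ W := hVW'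
  obtain ⟨ψ, hψ⟩ := exists_lift_of_isOpenImmersion (point s U) (point_apply s U _) hV hxV
  have hψ' : U.hom.appLE W V hVW ≫ ψ = χ := by
    apply Spec.map_injective
    rw [← cancel_mono hW.fromSpec, hχ, Spec.map_comp, Category.assoc,
      hW.SpecMap_appLE_fromSpec _ hV, ← Category.assoc, hψ, point_hom]
  refine ⟨Γ(U.left, V), U.hom.appLE W V hVW, U.hom.etale_appLE hW hV hVW, ψ, hψ',
    ⟨homOfPoint s hV.fromSpec ?_ ?_⟩⟩
  · exact (hW.SpecMap_appLE_fromSpec _ hV hVW).symm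
  · exact (congrArg (· ≫ hV.fromSpec) (point_affine s hW hχ _ hψ')).trans hψ

/-- A small set of data for étale neighbourhoods: a pointed étale algebra presented as a quotient
of a polynomial ring. -/
structure Presented (χ : Γ(Y, W) ⟶ .of K) : Type u where
  /-- The number of generators. -/
  n : ℕ
  /-- The ideal of relations. -/
  I : Ideal (MvPolynomial (Fin n) Γ(Y, W))
  etale : (algebraMap Γ(Y, W) (MvPolynomial (Fin n) Γ(Y, W) ⧸ I)).Etale
  /-- The rational point. -/
  ψ : CommRingCat.of (MvPolynomial (Fin n) Γ(Y, W) ⧸ I) ⟶ .of K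
  comp_ψ : CommRingCat.ofHom (algebraMap Γ(Y, W) (MvPolynomial (Fin n) Γ(Y, W) ⧸ I)) ≫ ψ = χ

/-- The étale neighbourhood of a pointed étale algebra given by a presentation. -/
def Presented.nhd (i : Presented χ) : EtaleNhd Y y :=
  affine s hW hχ (CommRingCat.ofHom (algebraMap _ _)) i.etale i.ψ i.comp_ψ

/-- Étale neighbourhoods form a large category. Étale algebras are of finite type, hence quotients
of polynomial rings in finitely many variables, so a small full subcategory is cofinal; this is why
the limit exists. -/
theorem exists_presented_hom (hy : y ∈ W) (U : EtaleNhd Y y) :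
    ∃ i : Presented χ, Nonempty (i.nhd s hW hχ ⟶ U) := by
  obtain ⟨A, φ, hφ, ψ, hψ, ⟨g⟩⟩ := exists_affine_hom s hW hχ hy U
  algebraize [φ.hom]
  have : Algebra.Etale Γ(Y, W) A := hφ
  obtain ⟨n, f, hf⟩ := (Algebra.FiniteType.iff_quotient_mvPolynomial'' (R := Γ(Y, W)) (S := A)).1
    inferInstance
  let e : (MvPolynomial (Fin n) Γ(Y, W) ⧸ RingHom.ker f) ≃ₐ[Γ(Y, W)] A :=
    Ideal.quotientKerAlgEquivOfSurjective hf
  have he : φ ≫ CommRingCat.ofHom e.symm.toRingHom = CommRingCat.ofHom (algebraMap _ _) := by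
    ext r
    exact e.symm.commutes r
  have hee : CommRingCat.ofHom e.symm.toRingHom ≫ CommRingCat.ofHom e.toRingHom = 𝟙 _ := by
    ext r
    exact e.apply_symm_apply r
  let i : Presented χ :=
    { n := n
      I := RingHom.ker f
      etale := by
        rw [RingHom.etale_algebraMap]
        exact Algebra.Etale.of_equiv e.symm
      ψ := CommRingCat.ofHom e.toRingHom ≫ ψ
      comp_ψ := by rw [← he, Category.assoc, reassoc_of% hee, hψ] }
  exact ⟨i, ⟨affineHom s hW hχ hφ hψ i.etale i.comp_ψ (CommRingCat.ofHom e.symm.toRingHom) he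
    (by rw [reassoc_of% hee]) ≫ g⟩⟩

/-- The diagram of the presented étale neighbourhoods. -/
abbrev presentedFunctor :
    InducedCategory (EtaleNhd Y y)ᵒᵖ (fun i : Presented χ => op (i.nhd s hW hχ)) ⥤
      (EtaleNhd Y y)ᵒᵖ :=
  inducedFunctor _

include hW hχ in
theorem isFiltered_presented (hy : y ∈ W) :
    IsFiltered (InducedCategory (EtaleNhd Y y)ᵒᵖ (fun i : Presented χ => op (i.nhd s hW hχ))) := by
  have := isCofiltered s
  refine IsFiltered.of_exists_of_isFiltered_of_fullyFaithful (presentedFunctor s hW hχ) fun U => ?_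
  obtain ⟨i, ⟨g⟩⟩ := exists_presented_hom s hW hχ hy U.unop
  exact ⟨i, ⟨g.op⟩⟩

theorem final_presentedFunctor (hy : y ∈ W) : (presentedFunctor s hW hχ).Final := by
  have := isCofiltered s
  refine Functor.final_of_exists_of_isFiltered_of_fullyFaithful _ fun U => ?_
  obtain ⟨i, ⟨g⟩⟩ := exists_presented_hom s hW hχ hy U.unop
  exact ⟨i, ⟨g.op⟩⟩

include hW hχ in
theorem hasColimit_sections (hy : y ∈ W) : HasColimit (sections Y y) := by
  have := final_presentedFunctor s hW hχ hy
  exact Functor.Final.hasColimit_of_comp (presentedFunctor s hW hχ)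

variable {c : Cocone (sections Y y)} (hc : IsColimit c)

include hc in
theorem exists_cls_presented_eq (hy : y ∈ W) (z : c.pt) :
    ∃ (i : Presented χ) (x : Γ((i.nhd s hW hχ).left, ⊤)), cls c (i.nhd s hW hχ) x = z := by
  have := final_presentedFunctor s hW hχ hy
  have := isFiltered_presented s hW hχ hy
  exact Concrete.isColimit_exists_rep _
    ((Functor.Final.isColimitWhiskerEquiv (presentedFunctor s hW hχ) c).symm hc) z

include hc in
theorem exists_appTop_eq_zero_presented (hy : y ∈ W) (i : Presented χ)
    (x : Γ((i.nhd s hW hχ).left, ⊤)) (hx : cls c (i.nhd s hW hχ) x = 0) :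
    ∃ (j : Presented χ) (g : j.nhd s hW hχ ⟶ i.nhd s hW hχ), (Mor.map g).appTop x = 0 := by
  have := final_presentedFunctor s hW hχ hy
  have := isFiltered_presented s hW hχ hy
  let i' : InducedCategory (EtaleNhd Y y)ᵒᵖ (fun i : Presented χ => op (i.nhd s hW hχ)) := i
  obtain ⟨j, f, g, hfg⟩ := Concrete.isColimit_exists_of_rep_eq _
    ((Functor.Final.isColimitWhiskerEquiv (presentedFunctor s hW hχ) c).symm hc)
    (i := i') (j := i') x 0 (hx.trans (map_zero (cls c (i.nhd s hW hχ)).hom).symm)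
  exact ⟨j, f.hom.unop, hfg.trans (map_zero (Mor.map g.hom.unop).appTop.hom)⟩

end Affine

/-! ### The limit as a colimit of pointed étale algebras. -/

section Colimit

variable {K : Type u} [Field K] [IsAlgClosed K] {Y : Scheme.{u}} {y : Y} (s : RationalPoint K Y y)

/-- The value of a regular function on an étale neighbourhood at the chosen point. -/
def eval (U : EtaleNhd Y y) : Γ(U.left, ⊤) ⟶ .of K :=
  (point s U).appTop ≫ (Scheme.ΓSpecIso (.of K)).hom

theorem map_eval {U V : EtaleNhd Y y} (g : U ⟶ V) :
    (Mor.map g).appTop ≫ eval s U = eval s V := by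
  rw [eval, eval, ← point_map s g, Scheme.Hom.comp_appTop, Category.assoc]

/-- The cocone of the values at the chosen points. -/
def evalCocone : Cocone (sections Y y) where
  pt := .of K
  ι :=
    { app := fun U => eval s U.unop
      naturality := fun _ _ g => (map_eval s g.unop).trans (Category.comp_id _).symm }

variable {c : Cocone (sections Y y)} (hc : IsColimit c)

/-- The value at `y` of an element of the local ring in the étale topology. -/
def evalHom : c.pt ⟶ .of K := hc.desc (evalCocone s)

theorem cls_evalHom (U : EtaleNhd Y y) : cls c U ≫ evalHom s hc = eval s U :=
  hc.fac (evalCocone s) (op U)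

variable [IsLocallyNoetherian Y] {W : Y.Opens} (hW : IsAffineOpen W) {χ : Γ(Y, W) ⟶ .of K}
  (hχ : Spec.map χ ≫ hW.fromSpec = s.hom)

variable {A A' : CommRingCat.{u}} {φ : Γ(Y, W) ⟶ A} (hφ : φ.hom.Etale) {ψ : A ⟶ .of K}
  (hψ : φ ≫ ψ = χ) {φ' : Γ(Y, W) ⟶ A'} (hφ' : φ'.hom.Etale) {ψ' : A' ⟶ .of K}
  (hψ' : φ' ≫ ψ' = χ)

variable (c) in
/-- The structure map of a cocone at an affine étale neighbourhood. -/
def specCls : Γ(Spec A, ⊤) ⟶ c.pt := cls c (affine s hW hχ φ hφ ψ hψ)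

theorem specCls_evalHom : specCls s c hW hχ hφ hψ ≫ evalHom s hc =
    (Spec.map ψ).appTop ≫ (Scheme.ΓSpecIso (.of K)).hom :=
  (cls_evalHom s hc _).trans (congrArg
    (fun l : Spec (.of K) ⟶ Spec A => l.appTop ≫ (Scheme.ΓSpecIso (.of K)).hom)
    (point_affine s hW hχ hφ hψ))

theorem map_specCls (β : A ⟶ A') (hβ : φ ≫ β = φ') (hβψ : β ≫ ψ' = ψ) :
    (Spec.map β).appTop ≫ specCls s c hW hχ hφ' hψ' = specCls s c hW hχ hφ hψ :=
  map_cls c (affineHom s hW hχ hφ hψ hφ' hψ' β hβ hβψ)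

/-- A morphism to an open neighbourhood, regarded as an étale neighbourhood. -/
def homOfOpen (V : Y.Opens) (hV : y ∈ V) (U : EtaleNhd Y y) (g : U.left ⟶ V.toScheme)
    (hg : g ≫ V.ι = U.hom) : U ⟶ ofOpen V hV where
  map := g
  comm := hg
  map_pt := V.ι.isOpenEmbedding.injective
    ((congrArg (fun g : U.left ⟶ Y => g U.pt) hg).trans U.map_pt)

omit [IsAlgClosed K] in
theorem clsOpen_eq (hy : y ∈ W) : clsOpen c W hy =
    W.topIso.inv ≫ (Spec.map φ ≫ hW.isoSpec.inv).appTop ≫ specCls s c hW hχ hφ hψ := by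
  have hg : (Spec.map φ ≫ hW.isoSpec.inv) ≫ W.ι = Spec.map φ ≫ hW.fromSpec := by
    rw [Category.assoc, hW.isoSpec_inv_ι]
  exact congrArg (fun k : Γ(W.toScheme, ⊤) ⟶ c.pt => W.topIso.inv ≫ k)
    (map_cls c (homOfOpen W hy (affine s hW hχ φ hφ ψ hψ) _ hg)).symm

variable (c) in
/-- The map from a pointed étale algebra to the colimit of the rings of functions on the étale
neighbourhoods. -/
def affineCls : A ⟶ c.pt :=
  (Scheme.ΓSpecIso A).inv ≫ specCls s c hW hχ hφ hψ

theorem affineCls_evalHom : affineCls s c hW hχ hφ hψ ≫ evalHom s hc = ψ := by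
  rw [affineCls, Category.assoc, specCls_evalHom, Scheme.ΓSpecIso_naturality,
    Iso.inv_hom_id_assoc]

theorem comp_affineCls (β : A ⟶ A') (hβ : φ ≫ β = φ') (hβψ : β ≫ ψ' = ψ) :
    β ≫ affineCls s c hW hχ hφ' hψ' = affineCls s c hW hχ hφ hψ := by
  rw [affineCls, affineCls, ← map_specCls s hW hχ hφ hψ hφ' hψ' β hβ hβψ,
    Scheme.ΓSpecIso_inv_naturality_assoc]

omit [IsAlgClosed K] in
theorem structure_affineCls (hy : y ∈ W) :
    φ ≫ affineCls s c hW hχ hφ hψ = clsOpen c W hy := by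
  rw [affineCls, clsOpen_eq s hW hχ hφ hψ hy, Scheme.Hom.comp_appTop,
    IsAffineOpen.isoSpec_inv_appTop, Category.assoc, Category.assoc, Iso.inv_hom_id_assoc,
    Scheme.ΓSpecIso_inv_naturality_assoc]

include hc in
theorem exists_affineCls_eq (hy : y ∈ W) (z : c.pt) :
    ∃ (A : CommRingCat.{u}) (φ : Γ(Y, W) ⟶ A) (hφ : φ.hom.Etale) (ψ : A ⟶ .of K)
      (hψ : φ ≫ ψ = χ) (a : A), affineCls s c hW hχ hφ hψ a = z := by
  obtain ⟨i, x, hx⟩ := exists_cls_presented_eq s hW hχ hc hy z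
  refine ⟨_, _, i.etale, i.ψ, i.comp_ψ, (Scheme.ΓSpecIso _).hom x, ?_⟩
  have h : (Scheme.ΓSpecIso (.of _)).hom ≫ affineCls s c hW hχ i.etale i.comp_ψ =
      specCls s c hW hχ i.etale i.comp_ψ := by rw [affineCls, Iso.hom_inv_id_assoc]
  exact (congrArg (fun k => k.hom x) h).trans hx

-- A function that is zero in the filtered colimit is zero on some finer presented neighbourhood,
-- and the transition morphism to it comes from an algebra map `β`.
include hc in
theorem exists_map_eq_zero_of_affineCls_eq_zero (hy : y ∈ W) (a : A)
    (ha : affineCls s c hW hχ hφ hψ a = 0) :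
    ∃ (A' : CommRingCat.{u}) (φ' : Γ(Y, W) ⟶ A') (_ : φ'.hom.Etale) (ψ' : A' ⟶ .of K)
      (_ : φ' ≫ ψ' = χ) (β : A ⟶ A'), φ ≫ β = φ' ∧ β ≫ ψ' = ψ ∧ β a = 0 := by
  obtain ⟨i, ⟨g⟩⟩ := exists_presented_hom s hW hχ hy (affine s hW hχ φ hφ ψ hψ)
  let x : Γ((affine s hW hχ φ hφ ψ hψ).left, ⊤) := (Scheme.ΓSpecIso A).inv a
  have hx : cls c (i.nhd s hW hχ) ((Mor.map g).appTop x) = 0 :=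
    (congrArg (fun k => k.hom x) (map_cls c g)).trans ha
  obtain ⟨j, g', hg'⟩ := exists_appTop_eq_zero_presented s hW hχ hc hy i _ hx
  have hgg : (Mor.map (g' ≫ g)).appTop x = 0 := hg'
  obtain ⟨β, hβ, hφβ, hβψ⟩ := exists_of_affine_hom s hW hχ hφ hψ j.etale j.comp_ψ (g' ≫ g)
  refine ⟨_, _, j.etale, j.ψ, j.comp_ψ, β, hφβ, hβψ, ?_⟩
  have h : (Scheme.ΓSpecIso _).inv (β a) = 0 :=
    (congrArg (fun k => k.hom a) (Scheme.ΓSpecIso_inv_naturality β)).trans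
      ((congrArg (fun k : Spec _ ⟶ Spec A => k.appTop x) hβ).symm.trans hgg)
  exact (map_eq_zero_iff _ (ConcreteCategory.injective_of_mono_of_preservesPullback _)).1 h

-- The structure morphism to `Spec K` makes `K → Γ(Y, W)` a section of `χ`.
include s hχ in
omit [IsAlgClosed K] [IsLocallyNoetherian Y] in
theorem surjective_of_specMap_fromSpec : Function.Surjective χ := by
  have h : Spec.preimage (hW.fromSpec ≫ s.str) ≫ χ = 𝟙 _ := by
    apply Spec.map_injective
    rw [Spec.map_comp, Spec.map_preimage, ← Category.assoc, hχ, s.hom_str, Spec.map_id]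
  exact fun k => ⟨Spec.preimage (hW.fromSpec ≫ s.str) k, congrArg (fun f => f.hom k) h⟩

include s hχ in
omit [IsAlgClosed K] [IsLocallyNoetherian Y] in
theorem primeIdealOf_eq_ker (hy : y ∈ W) :
    (hW.primeIdealOf ⟨y, hy⟩).asIdeal = RingHom.ker χ.hom := by
  have h : hW.primeIdealOf ⟨y, hy⟩ = Spec.map χ default := by
    apply hW.fromSpec.isOpenEmbedding.injective
    rw [hW.fromSpec_primeIdealOf, ← Scheme.Hom.comp_apply, hχ, s.hom_apply]
  rw [h]
  change Ideal.comap χ.hom _ = Ideal.comap χ.hom ⊥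
  congr 1

-- A function that does not vanish at the chosen point is invertible on the smaller neighbourhood
-- obtained by inverting it.
include hc hW hχ in
theorem isUnit_of_evalHom_ne_zero (hy : y ∈ W) (z : c.pt) (hz : evalHom s hc z ≠ 0) :
    IsUnit z := by
  obtain ⟨A, φ, hφ, ψ, hψ, a, rfl⟩ := exists_affineCls_eq s hc hW hχ hy z
  have ha : IsUnit (ψ a) := by
    rw [← CommRingCat.comp_apply, affineCls_evalHom] at hz
    exact hz.isUnit
  have hφ' : (φ ≫ CommRingCat.ofHom (algebraMap A (Localization.Away a))).hom.Etale := by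
    have := Algebra.Etale.of_isLocalizationAway (R := A) (A := Localization.Away a) a
    exact RingHom.Etale.stableUnderComposition _ _ hφ (RingHom.etale_algebraMap.2 this)
  let ψ' : CommRingCat.of (Localization.Away a) ⟶ .of K :=
    CommRingCat.ofHom (IsLocalization.Away.lift a (g := ψ.hom) ha)
  have hβψ : CommRingCat.ofHom (algebraMap A (Localization.Away a)) ≫ ψ' = ψ :=
    CommRingCat.hom_ext (IsLocalization.Away.lift_comp a ha)
  rw [← comp_affineCls s hW hχ hφ hψ hφ' (by rw [Category.assoc, hβψ, hψ]) _ rfl hβψ,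
    CommRingCat.comp_apply]
  exact (IsLocalization.Away.algebraMap_isUnit a).map _

theorem isEtaleColimit (hy : y ∈ W) [Algebra Γ(Y, W) K] [Algebra Γ(Y, W) c.pt]
    (hχ : Spec.map (CommRingCat.ofHom (algebraMap Γ(Y, W) K)) ≫ hW.fromSpec = s.hom)
    (hcls : CommRingCat.ofHom (algebraMap Γ(Y, W) c.pt) = clsOpen c W hy)
    (ε : c.pt →ₐ[Γ(Y, W)] K) (hε : ∀ z, ε z = evalHom s hc z) : IsEtaleColimit ε where
  surjective := surjective_of_specMap_fromSpec s hW hχ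
  isUnit_of_ne_zero z hz := isUnit_of_evalHom_ne_zero s hc hW hχ hy z (by rwa [← hε])
  exists_rep z := by
    obtain ⟨A, φ, hφ, ψ, hψ, a, rfl⟩ := exists_affineCls_eq s hc hW hχ hy z
    algebraize [φ.hom]
    exact ⟨A, inferInstance, inferInstance, hφ,
      { toRingHom := (affineCls s c hW hχ hφ hψ).hom
        commutes' := fun r => congrArg (fun k => k.hom r)
          ((structure_affineCls s hW hχ hφ hψ hy).trans hcls.symm) }, a, rfl⟩
  exists_lift A _ _ hA ψ := by
    have hφ : (CommRingCat.ofHom (algebraMap Γ(Y, W) A)).hom.Etale := RingHom.etale_algebraMap.2 hA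
    have hψ : CommRingCat.ofHom (algebraMap Γ(Y, W) A) ≫ CommRingCat.ofHom (ψ : A →+* K) =
        CommRingCat.ofHom (algebraMap Γ(Y, W) K) := CommRingCat.hom_ext ψ.comp_algebraMap
    refine ⟨{ toRingHom := (affineCls s c hW hχ hφ hψ).hom
              commutes' := fun r => congrArg (fun k => k.hom r)
                ((structure_affineCls s hW hχ hφ hψ hy).trans hcls.symm) }, ?_, fun a ha => ?_⟩
    · ext a
      exact (hε _).trans (congrArg (fun k => k.hom a) (affineCls_evalHom s hc hW hχ hφ hψ))
    · obtain ⟨A', φ', hφ', ψ', hψ', β, hβ, hβψ, hβa⟩ :=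
        exists_map_eq_zero_of_affineCls_eq_zero s hc hW hχ hφ hψ hy a ha
      algebraize [φ'.hom]
      refine ⟨A', inferInstance, inferInstance, hφ',
        { toRingHom := β.hom
          commutes' := fun r => congrArg (fun k => k.hom r) hβ },
        { toRingHom := (affineCls s c hW hχ hφ' hψ').hom
          commutes' := fun r => congrArg (fun k => k.hom r)
            ((structure_affineCls s hW hχ hφ' hψ' hy).trans hcls.symm) }, ?_, hβa⟩
      ext a
      exact congrArg (fun k : CommRingCat.of A ⟶ c.pt => k.hom a)
        (comp_affineCls s hW hχ hφ hψ hφ' hψ' β hβ hβψ)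

end Colimit

/-! ### Assembling the theorem. -/

section Main

variable {K : Type u} [Field K] [IsAlgClosed K] {Y : Scheme.{u}} [IsLocallyNoetherian Y]
  {y : Y} (s : RationalPoint K Y y)

include s

theorem hasColimit_sections_of_rationalPoint : HasColimit (sections Y y) := by
  obtain ⟨W, hW, hy, -⟩ := exists_isAffineOpen_mem_and_subset (U := ⊤) (Set.mem_univ y)
  obtain ⟨χ, hχ⟩ := exists_lift_of_isOpenImmersion s.hom s.hom_apply hW hy
  exact hasColimit_sections s hW hχ hy

theorem fromStalk_properties [AlgebraicGeometry.IsReduced Y] {c : Cocone (sections Y y)}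
    (hc : IsColimit c) :
    IsHenselisation.{u, u, w} (fromStalk c).hom ∧ IsSmallestHenselian (fromStalk c).hom ∧
      (∀ [IsDomain (Y.presheaf.stalk y)], IsIntegrallyClosed (Y.presheaf.stalk y) →
        IsDomain c.pt) := by
  obtain ⟨W, hW, hy, -⟩ := exists_isAffineOpen_mem_and_subset (U := ⊤) (Set.mem_univ y)
  obtain ⟨χ, hχ⟩ := exists_lift_of_isOpenImmersion s.hom s.hom_apply hW hy
  let _ : Algebra Γ(Y, W) K := χ.hom.toAlgebra
  let _ : Algebra Γ(Y, W) c.pt := (clsOpen c W hy).hom.toAlgebra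
  let _ : Algebra Γ(Y, W) (Y.presheaf.stalk y) := (Y.presheaf.germ W y hy).hom.toAlgebra
  let _ : Algebra (Y.presheaf.stalk y) c.pt := (fromStalk c).hom.toAlgebra
  have : IsScalarTower Γ(Y, W) (Y.presheaf.stalk y) c.pt :=
    .of_algebraMap_eq' (congrArg CommRingCat.Hom.hom (germ_fromStalk c W hy)).symm
  -- The identity is the étale algebra of `W` itself; it shows that evaluation restricts to `χ` on
  -- `Γ(Y, W)`.
  have hid : (𝟙 Γ(Y, W) : Γ(Y, W) ⟶ _).hom.Etale := RingHom.Etale.containsIdentities _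
  let ε : c.pt →ₐ[Γ(Y, W)] K :=
    { toRingHom := (evalHom s hc).hom
      commutes' := fun r => by
        have h := affineCls_evalHom s hc hW hχ hid (Category.id_comp χ)
        have h' := structure_affineCls s (c := c) hW hχ hid (Category.id_comp χ) hy
        rw [Category.id_comp] at h'
        rw [h'] at h
        exact congrArg (fun k => k.hom r) h }
  have h : IsEtaleColimit ε := isEtaleColimit s hc hW hy hχ rfl ε fun _ => rfl
  have hp : (hW.primeIdealOf ⟨y, hy⟩).asIdeal = RingHom.ker (algebraMap Γ(Y, W) K) :=
    primeIdealOf_eq_ker s hW hχ hy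
  have : IsLocalization.AtPrime (Y.presheaf.stalk y) (hW.primeIdealOf ⟨y, hy⟩).asIdeal :=
    hW.isLocalization_stalk ⟨y, hy⟩
  have : IsNoetherianRing Γ(Y, W) := IsLocallyNoetherian.component_noetherian ⟨W, hW⟩
  exact ⟨h.isHenselisation _ hp, h.isSmallestHenselian _ hp,
    fun _ => h.isDomain (O := Y.presheaf.stalk y)⟩

end Main

end EtaleNhd
end

theorem theorem5p5 {K : Type u} [Field K] [IsAlgClosed K] (Y : AlgVariety K) (y : Y.Point) :
    Limits.HasColimit (EtaleNhd.sections Y.toScheme y.1) ∧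
    ∀ c : Limits.Cocone (EtaleNhd.sections Y.toScheme y.1), Nonempty (Limits.IsColimit c) →
      IsHenselisation.{u, u, w} (EtaleNhd.fromStalk c).hom ∧
      IsSmallestHenselian (EtaleNhd.fromStalk c).hom ∧
      (∀ [IsLocalRing c.pt], MultivariableHensel c.pt) ∧
      (∀ [IsDomain (Y.localRing y)], IsIntegrallyClosed (Y.localRing y) → IsDomain c.pt) ∧
      (∀ [IsDomain (Y.localRing y)], IsDomain c.pt →
        IsSmallestHenselianInClosure (EtaleNhd.fromStalk c).hom) := by
  refine ⟨EtaleNhd.hasColimit_sections_of_rationalPoint (Y.rationalPoint y), fun c ⟨hc⟩ => ?_⟩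
  obtain ⟨h₁, h₂, h₃⟩ := EtaleNhd.fromStalk_properties.{u, w} (Y.rationalPoint y) hc
  -- Subrings of the algebraic closure live in universe `u`, so the universal property is needed
  -- there as well as in `w`.
  obtain ⟨h₁', -, -⟩ := EtaleNhd.fromStalk_properties.{u, u} (Y.rationalPoint y) hc
  refine ⟨h₁, h₂, ?_, h₃, ?_⟩
  · intro
    have := h₁.henselian
    exact HenselianLocalRing.multivariableHensel c.pt
  · intro _ _
    algebraize [(EtaleNhd.fromStalk c).hom]
    have : FaithfulSMul (Y.localRing y) c.pt :=
      (faithfulSMul_iff_algebraMap_injective _ _).2 h₂.injective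
    have : Algebra.IsAlgebraic (Y.localRing y) c.pt := ⟨fun z => by
      obtain ⟨p, hp, hz⟩ := h₂.algebraic z
      exact ⟨p, Polynomial.leadingCoeff_ne_zero.1 (nonZeroDivisors.ne_zero hp), hz⟩⟩
    exact h₁'.isSmallestHenselianInClosure
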